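/- Let $L$ be odd, $\theta\in\mathbb R$, and consider $N$ fermions on the periodic chain $\{1,\dots,L\}$ with Hamiltonian $$\hat H=\sum_{x=1}^{L}\bigl(e^{i\theta}\hat c_x^\dagger \hat c_{x+1}+e^{-i\theta}\hat c_{x+1}^\dagger \hat c_x\bigr),\qquad \hat c_{L+1}=\hat c_1 .$$ Write $\rho=N/L$, let $\hat N_{\mathrm{left}}=\sum_{x=1}^{(L-1)/2}\hat c_x^\dagger\hat c_x$, and let $\mathcal H_1$ be the space of $N$-particle states in which all particles are in $\{1,\dots,(L-1)/2\}$. Let $\mu$ be Lebesgue measure on $\mathbb R$. (i) For every $\rho_0>0$ there is an $N_0$ such that the following holds for all $N\ge N_0$ and all odd $L$ with $\rho_0\le\rho\le 1/5$, and for every $\theta$ for which all the energy eigenvalues of $\hat H$ on the $N$-particle space are nondegenerate. Draw $\Phi(0)$ from the uniform distribution on the unit sphere of $\mathcal H_1$ and put $\Phi(t)=e^{-i\hat Ht}\Phi(0)$. Then, with probability larger than $1-e^{-(\rho/3)N}$, there are $T>0$ and a set $G\subset[0,T]$, a finite union of intervals, with $$\frac{\mu(G)}{T}\ge 1-e^{-(\rho/4)N},$$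 such that for every $t\in G$ the result $N_{\mathrm{left}}$ of a projective measurement of $\hat N_{\mathrm{left}}$ in the state $\Phi(t)$ satisfies $$\Bigl|\frac{N_{\mathrm{left}}}{N}-\frac12\Bigr|\le\sqrt{\tfrac32\rho}$$ with probability larger than $1-e^{-(\rho/4)N}$. (ii) If $L$ is an odd prime and $1\le N\le (L-1)/4$, then all the energy eigenvalues of $\hat H$ on the $N$-particle space are nondegenerate for $\theta=(4N)^{-(L-1)/2}$. -/

import Mathlib

open MeasureTheory

noncomputable section

namespace FermionChain

/-- The Fock space of fermions on the chain `{1, …, L}` in the occupation number representation.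
The sites are indexed by `Fin L` (the index `x` stands for the site `x + 1`), and the standard
orthonormal basis is labelled by the sets of occupied sites: the basis vector of
`s = {x₁ < ⋯ < xₙ}` is `c†_{x₁} ⋯ c†_{xₙ} |vac⟩`. -/
abbrev Fock (L : ℕ) : Type := EuclideanSpace ℂ (Finset (Fin L))

/-- The creation operator `c†_x`. It maps the basis vector of `s` to zero if `x ∈ s`, and otherwise
to the basis vector of `s ∪ {x}` times the fermionic sign `(-1)^#{y ∈ s | y < x}`. -/
def create {L : ℕ} (x : Fin L) : Fock L →L[ℂ] Fock L :=
  Matrix.toEuclideanCLM (n := Finset (Fin L)) (𝕜 := ℂ)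
    (Matrix.of fun s' s =>
      if x ∉ s ∧ s' = insert x s then (-1 : ℂ) ^ (s.filter (fun y => y < x)).card else 0)

/-- The annihilation operator `c_x`, the adjoint of `c†_x`. -/
def annihilate {L : ℕ} (x : Fin L) : Fock L →L[ℂ] Fock L :=
  ContinuousLinearMap.adjoint (create x)

/-- The Hamiltonian
`H = ∑_{x=1}^{L} (e^{iθ} c†_x c_{x+1} + e^{-iθ} c†_{x+1} c_x)` with `c_{L+1} = c_1`;
`finRotate L` is the cyclic shift `x ↦ x + 1` of the sites. -/
def hamiltonian (L : ℕ) (θ : ℝ) : Fock L →L[ℂ] Fock L :=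
  ∑ x : Fin L,
    (Complex.exp (Complex.I * θ) • (create x ∘L annihilate (finRotate L x)) +
      Complex.exp (-(Complex.I * θ)) • (create (finRotate L x) ∘L annihilate x))

/-- The operator `∑_{x ∈ S} c†_x c_x` that counts the particles in the region `S`. -/
def numberOp {L : ℕ} (S : Finset (Fin L)) : Fock L →L[ℂ] Fock L :=
  ∑ x ∈ S, create x ∘L annihilate x

/-- The left half `{1, …, (L-1)/2}` of the chain. -/
def leftHalf (L : ℕ) : Finset (Fin L) :=
  Finset.univ.filter fun x => (x : ℕ) < (L - 1) / 2

/-- The eigenspace of the operator `A` for the value `a`, the zero space if `a` is not an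
eigenvalue. -/
def eigenspace {L : ℕ} (A : Fock L →L[ℂ] Fock L) (a : ℂ) : Submodule ℂ (Fock L) :=
  Module.End.eigenspace (A : Fock L →ₗ[ℂ] Fock L) a

/-- The Hilbert space of `N` fermions on the chain. -/
def sector (L N : ℕ) : Submodule ℂ (Fock L) :=
  eigenspace (numberOp Finset.univ) (N : ℂ)

/-- The space of the `N`-particle states in which all particles are in the left half. -/
def leftSector (L N : ℕ) : Submodule ℂ (Fock L) :=
  sector L N ⊓ eigenspace (numberOp (leftHalf L)) (N : ℂ)

/-- All energy eigenvalues of the `N`-particle system are nondegenerate. -/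
def Nondegenerate (L N : ℕ) (θ : ℝ) : Prop :=
  ∀ E : ℂ, Module.finrank ℂ ↥(sector L N ⊓ eigenspace (hamiltonian L θ) E) ≤ 1

/-- The time evolution `e^{-iHt}`. -/
def evolution (L : ℕ) (θ t : ℝ) : Fock L →L[ℂ] Fock L :=
  NormedSpace.exp ((-(Complex.I * t)) • hamiltonian L θ)

/-- The spectral subspace of the observable `A` for the set of values `B`. -/
def spectralSubspace {L : ℕ} (A : Fock L →L[ℂ] Fock L) (B : Set ℝ) : Submodule ℂ (Fock L) :=
  ⨆ b ∈ B, eigenspace A ((b : ℝ) : ℂ)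

/-- The Born rule: the probability that a projective measurement of the observable `A` in the
normalized state `ψ` gives a value in `B`. -/
def measureProb {L : ℕ} (A : Fock L →L[ℂ] Fock L) (B : Set ℝ) (ψ : Fock L) : ℝ :=
  ‖(spectralSubspace A B).starProjection ψ‖ ^ 2

/-- The uniform probability distribution on the unit sphere of a finite-dimensional complex inner
product space: the normalized surface measure. (It is zero if the space is zero.) -/
def uniformOnSphere (E : Type*) [NormedAddCommGroup E] [InnerProductSpace ℂ E]
    [FiniteDimensional ℂ E] [MeasurableSpace E] [BorelSpace E] :
    Measure (Metric.sphere (0 : E) 1) :=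
  letI : InnerProductSpace ℝ E := InnerProductSpace.complexToReal
  haveI : FiniteDimensional ℝ E := FiniteDimensional.complexToReal E
  ((volume : Measure E).toSphere Set.univ)⁻¹ • (volume : Measure E).toSphere

/-- The set `G` is a union of finitely many intervals (of any kind). -/
def IsFiniteUnionOfIntervals (G : Set ℝ) : Prop :=
  ∃ I : Set (Set ℝ), I.Finite ∧ (∀ J ∈ I, J.OrdConnected) ∧ G = ⋃₀ I

end FermionChain

end

namespace FermionChain

variable {L : ℕ}

/-! ### Canonical anticommutation relations -/

/-! The fermions are free: the Slater determinants of plane waves form an orthonormal eigenbasis of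
the Hamiltonian for every `θ`, and the energies are the subset sums of `2 cos(2πk/L + θ)`.

Part (i). Already in each single eigenstate the left half holds about half of the particles. Plane
waves have constant density `1/L`, and a creation operator has norm at most that of its wave
function. Hence the exponential moment of the particle number in a region is at most that of `N`
independent, uniformly placed particles (`sum_exp_mul_norm_sq_energyBasis_le`). The Chernoff bound
then gives an unbalanced probability of at most `3 exp(-3ρN)` (`unbalanced_energyBasis_le`). For
nondegenerate energies the cross terms vanish in the long-time average
(`tendsto_average_unbalanced`), so the averaged unbalanced probability obeys the same bound for
every normalized initial state. Markov's inequality in time (`exists_intervals_of_average_lt`)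
yields the good set of times. No initial state is exceptional, so the event of the theorem is the
whole sphere.

Part (ii). Suppose that `K ≠ K'` have equal energies and let `A` be the difference of their sums of
powers of `ζ = e^{2πi/L}`. Then `Re(e^{iθ} A) = 0`, so `|Re A| = |A| |sin θ|` is tiny. But `2 Re A`
is an algebraic integer of the cyclotomic field whose conjugates are at most `4N` in modulus. Since
its norm is a nonzero integer if `A ≠ 0`, it cannot be that small (`one_le_norm_symmSumDiff`). Hence
`A = 0`, and for prime `L` this forces `K = K'` (`eq_of_sum_chainRoot_eq`). -/

/-- The fermionic sign `(-1)^#{y ∈ s | y < x}`. -/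
noncomputable def fermiSign (x : Fin L) (s : Finset (Fin L)) : ℂ :=
  (-1) ^ (s.filter (fun y => y < x)).card

lemma fermiSign_mul_self (x : Fin L) (s : Finset (Fin L)) :
    fermiSign x s * fermiSign x s = 1 := by
  rw [fermiSign, ← mul_pow]; simp

lemma fermiSign_insert {x : Fin L} {s : Finset (Fin L)} (h : x ∉ s) (y : Fin L) :
    fermiSign y (insert x s) = (if x < y then -1 else 1) * fermiSign y s := by
  unfold fermiSign
  rw [Finset.filter_insert]
  split_ifs with hxy
  · rw [Finset.card_insert_of_notMem (by simp [h]), pow_succ']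
  · simp

lemma fermiSign_erase {x : Fin L} {s : Finset (Fin L)} (h : x ∈ s) (y : Fin L) :
    fermiSign y (s.erase x) = (if x < y then -1 else 1) * fermiSign y s := by
  conv_rhs => rw [← Finset.insert_erase h, fermiSign_insert (Finset.notMem_erase x s)]
  split_ifs <;> ring

lemma create_apply (x : Fin L) (v : Fock L) (s : Finset (Fin L)) :
    create x v s = if x ∈ s then fermiSign x s * v (s.erase x) else 0 := by
  unfold create
  rw [Matrix.ofLp_toEuclideanCLM, Matrix.mulVec, dotProduct]
  split_ifs with hx
  · rw [Finset.sum_eq_single (s.erase x)]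
    · simp [fermiSign_erase hx, Finset.insert_erase hx, ← fermiSign.eq_1]
    · intro t _ ht
      rw [Matrix.of_apply, if_neg, zero_mul]
      rintro ⟨h1, rfl⟩
      exact ht (Finset.erase_insert h1).symm
    · simp
  · refine Finset.sum_eq_zero fun t _ => ?_
    rw [Matrix.of_apply, if_neg, zero_mul]
    rintro ⟨-, rfl⟩
    exact hx (Finset.mem_insert_self x t)

lemma annihilate_apply (x : Fin L) (v : Fock L) (s : Finset (Fin L)) :
    annihilate x v s = if x ∉ s then fermiSign x s * v (insert x s) else 0 := by
  unfold annihilate create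
  rw [← ContinuousLinearMap.star_eq_adjoint, ← map_star, Matrix.ofLp_toEuclideanCLM,
    Matrix.mulVec, dotProduct]
  by_cases hx : x ∉ s
  · rw [if_pos hx, Finset.sum_eq_single (insert x s)]
    · simp [Matrix.star_apply, hx, fermiSign]
    · intro t _ ht
      rw [Matrix.star_apply, Matrix.of_apply, if_neg, star_zero, zero_mul]
      rintro ⟨_, rfl⟩
      exact ht rfl
    · simp
  · rw [if_neg hx]
    refine Finset.sum_eq_zero fun t _ => ?_
    rw [Matrix.star_apply, Matrix.of_apply, if_neg, star_zero, zero_mul]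
    rintro ⟨h, _⟩
    exact hx h

lemma create_create (x y : Fin L) (v : Fock L) :
    create x (create y v) + create y (create x v) = 0 := by
  ext s
  rw [PiLp.add_apply]
  simp only [create_apply, PiLp.zero_apply]
  rcases eq_or_ne x y with rfl | hxy
  · simp
  · by_cases hx : x ∈ s <;> by_cases hy : y ∈ s <;>
      simp only [hx, hy, Finset.mem_erase, hxy, hxy.symm, ne_eq, not_false_eq_true, and_true,
        and_false, if_true, if_false, mul_zero, add_zero]
    rw [fermiSign_erase hx, fermiSign_erase hy, Finset.erase_right_comm]
    rcases lt_or_gt_of_ne hxy with h | h <;> simp [h, h.not_gt] <;> ring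

lemma annihilate_create (x y : Fin L) (v : Fock L) :
    annihilate x (create y v) + create y (annihilate x v) = if x = y then v else 0 := by
  ext s
  rw [PiLp.add_apply]
  simp only [create_apply, annihilate_apply]
  rcases eq_or_ne x y with rfl | hxy
  · by_cases hx : x ∈ s
    · simp [hx, ← mul_assoc, fermiSign_erase hx, fermiSign_mul_self, Finset.insert_erase]
    · simp [hx, ← mul_assoc, fermiSign_insert hx, fermiSign_mul_self]
  · by_cases hx : x ∈ s <;> by_cases hy : y ∈ s <;>
      simp only [hx, hy, Finset.mem_erase, Finset.mem_insert, hxy, hxy.symm, ne_eq,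
        not_false_eq_true, not_true_eq_false, and_true, false_or, or_true,
        and_false, if_true, if_false, mul_zero, add_zero, PiLp.zero_apply]
    rw [fermiSign_insert hx, fermiSign_erase hy, Finset.erase_insert_of_ne hxy]
    rcases lt_or_gt_of_ne hxy with h | h <;> simp [h, h.not_gt] <;> ring

/-- The commutator `[c†_x c_y, c†_z] = δ_{yz} c†_x`: quadratic operators act on products of creation
operators as derivations. -/
lemma hop_create (x y z : Fin L) (v : Fock L) :
    create x (annihilate y (create z v)) =
      create z (create x (annihilate y v)) + if y = z then create x v else 0 := by
  have h1 := congrArg (create x) (annihilate_create y z v)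
  have h2 := create_create x z (annihilate y v)
  rw [map_add] at h1
  rw [eq_sub_of_add_eq h1, eq_neg_of_add_eq_zero_left h2, sub_neg_eq_add, add_comm]
  split_ifs <;> simp

lemma number_apply (x : Fin L) (v : Fock L) (s : Finset (Fin L)) :
    create x (annihilate x v) s = if x ∈ s then v s else 0 := by
  rw [create_apply, annihilate_apply]
  by_cases hx : x ∈ s
  · simp [hx, ← mul_assoc, fermiSign_erase hx, fermiSign_mul_self, Finset.insert_erase]
  · simp [hx]

lemma numberOp_apply (S : Finset (Fin L)) (v : Fock L) (s : Finset (Fin L)) :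
    numberOp S v s = ((S ∩ s).card : ℂ) * v s := by
  unfold numberOp
  rw [sum_apply, WithLp.ofLp_sum, Finset.sum_apply]
  simp only [ContinuousLinearMap.comp_apply, number_apply]
  rw [← Finset.sum_filter, Finset.sum_const, Finset.filter_mem_eq_inter, nsmul_eq_mul]

lemma mem_eigenspace_numberOp {S : Finset (Fin L)} {a : ℂ} {v : Fock L} :
    v ∈ eigenspace (numberOp S) a ↔ ∀ s, v s ≠ 0 → ((S ∩ s).card : ℂ) = a := by
  rw [eigenspace, Module.End.mem_eigenspace_iff]
  constructor
  · intro h s hs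
    have := congrArg (fun w : Fock L => w s) h
    simp only [ContinuousLinearMap.coe_coe, numberOp_apply, PiLp.smul_apply, smul_eq_mul] at this
    exact mul_right_cancel₀ hs this
  · intro h
    ext s
    simp only [ContinuousLinearMap.coe_coe, numberOp_apply, PiLp.smul_apply, smul_eq_mul]
    by_cases hs : v s = 0
    · simp [hs]
    · rw [h s hs]

/-! ### Creation operators of one-particle states -/

/-- The operator `∑ₓ f(x) c†_x` that creates a particle with wave function `f`. -/
noncomputable def fieldCreate (f : Fin L → ℂ) : Fock L →L[ℂ] Fock L :=
  ∑ x, f x • create x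

/-- The adjoint of `fieldCreate f`. -/
noncomputable def fieldAnnihilate (f : Fin L → ℂ) : Fock L →L[ℂ] Fock L :=
  ContinuousLinearMap.adjoint (fieldCreate f)

lemma fieldCreate_apply (f : Fin L → ℂ) (v : Fock L) :
    fieldCreate f v = ∑ x, f x • create x v := by
  simp [fieldCreate]

lemma fieldAnnihilate_apply (f : Fin L → ℂ) (v : Fock L) :
    fieldAnnihilate f v = ∑ x, star (f x) • annihilate x v := by
  simp [fieldAnnihilate, fieldCreate, annihilate, map_smulₛₗ]

lemma fieldCreate_fieldCreate (f g : Fin L → ℂ) (v : Fock L) :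
    fieldCreate f (fieldCreate g v) + fieldCreate g (fieldCreate f v) = 0 := by
  simp only [fieldCreate_apply, map_sum, map_smul, Finset.smul_sum]
  rw [Finset.sum_comm, ← Finset.sum_add_distrib]
  refine Finset.sum_eq_zero fun x _ => ?_
  rw [← Finset.sum_add_distrib]
  refine Finset.sum_eq_zero fun y _ => ?_
  rw [smul_comm, ← smul_add, ← smul_add, create_create, smul_zero, smul_zero]

lemma fieldAnnihilate_fieldCreate (f g : Fin L → ℂ) (v : Fock L) :
    fieldAnnihilate f (fieldCreate g v) + fieldCreate g (fieldAnnihilate f v) =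
      (∑ x, star (f x) * g x) • v := by
  simp only [fieldCreate_apply, fieldAnnihilate_apply, map_sum, map_smul, Finset.smul_sum]
  rw [Finset.sum_comm, ← Finset.sum_add_distrib, Finset.sum_smul]
  refine Finset.sum_congr rfl fun x _ => ?_
  rw [← Finset.sum_add_distrib]
  refine (Finset.sum_congr rfl fun y _ => ?_).trans
    ((Finset.sum_ite_eq Finset.univ x fun _ => (star (f x) * g x) • v).trans
      (if_pos (Finset.mem_univ x)))
  rw [smul_comm, ← smul_add, ← smul_add, annihilate_create]
  split_ifs with h
  · rw [h, smul_smul, mul_comm]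
  · simp

/-- Take the expectation in `v` of the anticommutation relation of `fieldCreate f` with its adjoint.
-/
lemma norm_sq_fieldCreate (f : Fin L → ℂ) (v : Fock L) :
    ‖fieldCreate f v‖ ^ 2 + ‖fieldAnnihilate f v‖ ^ 2 = (∑ x, ‖f x‖ ^ 2) * ‖v‖ ^ 2 := by
  have h := congrArg (fun w => inner ℂ v w) (fieldAnnihilate_fieldCreate f f v)
  simp only [inner_add_right, inner_smul_right] at h
  have h1 : inner ℂ v (fieldAnnihilate f (fieldCreate f v)) =
      ((‖fieldCreate f v‖ ^ 2 : ℝ) : ℂ) := by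
    rw [fieldAnnihilate, ContinuousLinearMap.adjoint_inner_right, inner_self_eq_norm_sq_to_K]
    simp
  have h2 : inner ℂ v (fieldCreate f (fieldAnnihilate f v)) =
      ((‖fieldAnnihilate f v‖ ^ 2 : ℝ) : ℂ) := by
    rw [← ContinuousLinearMap.adjoint_inner_left, ← fieldAnnihilate, inner_self_eq_norm_sq_to_K]
    simp
  have h3 : ∑ x, star (f x) * f x = ((∑ x, ‖f x‖ ^ 2 : ℝ) : ℂ) := by
    push_cast
    refine Finset.sum_congr rfl fun x _ => ?_
    rw [Complex.star_def, Complex.conj_mul']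
  rw [h1, h2, h3, inner_self_eq_norm_sq_to_K] at h
  apply Complex.ofReal_injective
  push_cast at h ⊢
  exact h

lemma norm_sq_fieldCreate_le (f : Fin L → ℂ) (v : Fock L) :
    ‖fieldCreate f v‖ ^ 2 ≤ (∑ x, ‖f x‖ ^ 2) * ‖v‖ ^ 2 := by
  rw [← norm_sq_fieldCreate]
  exact le_add_of_nonneg_right (sq_nonneg _)

/-! ### Slater determinants -/

/-- The state without particles. -/
noncomputable def vacuum (L : ℕ) : Fock L := EuclideanSpace.single ∅ 1

lemma annihilate_vacuum (x : Fin L) : annihilate x (vacuum L) = 0 := by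
  ext s
  rw [annihilate_apply]
  simp [vacuum]

lemma fieldAnnihilate_vacuum (f : Fin L → ℂ) : fieldAnnihilate f (vacuum L) = 0 := by
  simp [fieldAnnihilate_apply, annihilate_vacuum]

/-- The state in which the particles created successively occupy the orbitals `φ k`, `k ∈ l`. -/
noncomputable def slater (φ : Fin L → Fin L → ℂ) (l : List (Fin L)) : Fock L :=
  l.foldr (fun k v => fieldCreate (φ k) v) (vacuum L)

lemma slater_cons (φ : Fin L → Fin L → ℂ) (k : Fin L) (l : List (Fin L)) :
    slater φ (k :: l) = fieldCreate (φ k) (slater φ l) := rfl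

/-- If every orbital is an eigenvector of `[D, ·]`, the eigenvalues add up. This serves for the
occupation numbers, the total particle number and the Hamiltonian. -/
lemma slater_eigenvector {φ : Fin L → Fin L → ℂ} {D : Fock L →L[ℂ] Fock L} {d : Fin L → ℂ}
    (h0 : D (vacuum L) = 0)
    (hD : ∀ k v, D (fieldCreate (φ k) v) = fieldCreate (φ k) (D v) + d k • fieldCreate (φ k) v)
    (l : List (Fin L)) : D (slater φ l) = (l.map d).sum • slater φ l := by
  induction l with
  | nil => simpa [slater] using h0
  | cons k l ih =>
    rw [slater_cons, hD, ih, map_smul, List.map_cons, List.sum_cons, add_smul, add_comm]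

/-- The orbitals `φ k` are orthonormal. -/
def IsOrthonormalOrbitals (φ : Fin L → Fin L → ℂ) : Prop :=
  ∀ j k, ∑ x, star (φ j x) * φ k x = if j = k then 1 else 0

lemma IsOrthonormalOrbitals.sum_norm_sq {φ : Fin L → Fin L → ℂ} (hφ : IsOrthonormalOrbitals φ)
    (k : Fin L) : ∑ x, ‖φ k x‖ ^ 2 = 1 := by
  have h := hφ k k
  rw [if_pos rfl] at h
  apply Complex.ofReal_injective
  push_cast
  rw [← h]
  refine Finset.sum_congr rfl fun x _ => ?_
  rw [Complex.star_def, Complex.conj_mul']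

/-- Repeated orbitals in `l` need no exclusion: the derivation argument counts multiplicity, and
such a Slater determinant vanishes anyway. -/
lemma occupation_slater {φ : Fin L → Fin L → ℂ} (hφ : IsOrthonormalOrbitals φ) (k : Fin L)
    (l : List (Fin L)) :
    fieldCreate (φ k) (fieldAnnihilate (φ k) (slater φ l)) = (l.count k : ℂ) • slater φ l := by
  have h := slater_eigenvector (φ := φ) (d := fun j => if j = k then 1 else 0)
    (D := fieldCreate (φ k) ∘L fieldAnnihilate (φ k)) (by simp [fieldAnnihilate_vacuum]) ?_ l
  · rw [ContinuousLinearMap.comp_apply] at h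
    rw [h, List.count_eq_countP, List.countP_eq_length_filter]
    congr 1
    clear h
    induction l with
    | nil => simp
    | cons j l ih => by_cases hj : j = k <;> simp_all [add_comm]
  · intro j v
    have h1 := congrArg (fieldCreate (φ k)) (fieldAnnihilate_fieldCreate (φ k) (φ j) v)
    have h2 := fieldCreate_fieldCreate (φ k) (φ j) (fieldAnnihilate (φ k) v)
    rw [map_add, map_smul, hφ] at h1
    simp only [ContinuousLinearMap.comp_apply]
    rw [eq_sub_of_add_eq h1, eq_neg_of_add_eq_zero_left h2, sub_neg_eq_add, add_comm]
    by_cases hjk : j = k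
    · simp [hjk]
    · simp [hjk, Ne.symm hjk]

lemma norm_slater {φ : Fin L → Fin L → ℂ} (hφ : IsOrthonormalOrbitals φ) {l : List (Fin L)}
    (hl : l.Nodup) : ‖slater φ l‖ = 1 := by
  induction l with
  | nil => simp [slater, vacuum]
  | cons k l ih =>
    rw [List.nodup_cons] at hl
    have h0 : fieldAnnihilate (φ k) (slater φ l) = 0 := by
      have h := congrArg (fun w => inner ℂ (slater φ l) w) (occupation_slater hφ k l)
      simp only [List.count_eq_zero_of_not_mem hl.1, Nat.cast_zero, zero_smul,
        inner_zero_right] at h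
      rw [← ContinuousLinearMap.adjoint_inner_left] at h
      exact inner_self_eq_zero.mp h
    have h := norm_sq_fieldCreate (φ k) (slater φ l)
    rw [h0, ih hl.2, hφ.sum_norm_sq, ← slater_cons] at h
    rw [one_pow, mul_one, norm_zero, zero_pow two_ne_zero, add_zero] at h
    exact (pow_eq_one_iff_of_nonneg (norm_nonneg _) two_ne_zero).mp h

/-- Eigenvectors of the self-adjoint occupation operator of the orbital `k` with different
eigenvalues are orthogonal. -/
lemma inner_slater_eq_zero {φ : Fin L → Fin L → ℂ} (hφ : IsOrthonormalOrbitals φ)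
    {l m : List (Fin L)} {k : Fin L} (h : l.count k ≠ m.count k) :
    inner ℂ (slater φ l) (slater φ m) = 0 := by
  have h1 : inner ℂ (slater φ l) (fieldCreate (φ k) (fieldAnnihilate (φ k) (slater φ m))) =
      inner ℂ (fieldCreate (φ k) (fieldAnnihilate (φ k) (slater φ l))) (slater φ m) := by
    rw [← ContinuousLinearMap.adjoint_inner_left, ← fieldAnnihilate, fieldAnnihilate,
      ContinuousLinearMap.adjoint_inner_right]
  rw [occupation_slater hφ, occupation_slater hφ, inner_smul_left, inner_smul_right,
    Complex.conj_natCast] at h1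
  by_contra h0
  exact h (Nat.cast_injective (R := ℂ) (mul_right_cancel₀ h0 h1)).symm

lemma orthonormal_slater {φ : Fin L → Fin L → ℂ} (hφ : IsOrthonormalOrbitals φ) :
    Orthonormal ℂ fun K : Finset (Fin L) => slater φ K.toList := by
  refine ⟨fun K => norm_slater hφ K.nodup_toList, fun K K' hK => ?_⟩
  obtain ⟨k, hk⟩ : ∃ k, ¬(k ∈ K ↔ k ∈ K') := by
    by_contra! h
    exact hK (Finset.ext h)
  refine inner_slater_eq_zero hφ (k := k) ?_
  rw [List.Nodup.count K.nodup_toList, List.Nodup.count K'.nodup_toList]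
  simp only [Finset.mem_toList]
  split_ifs <;> simp_all

/-- The orthonormal basis of the Fock space that consists of the Slater determinants of
orthonormal orbitals. -/
noncomputable def slaterBasis {φ : Fin L → Fin L → ℂ} (hφ : IsOrthonormalOrbitals φ) :
    OrthonormalBasis (Finset (Fin L)) ℂ (Fock L) :=
  (basisOfOrthonormalOfCardEqFinrank (orthonormal_slater hφ) (by simp)).toOrthonormalBasis
    (by simpa using orthonormal_slater hφ)

lemma slaterBasis_apply {φ : Fin L → Fin L → ℂ} (hφ : IsOrthonormalOrbitals φ)
    (K : Finset (Fin L)) : slaterBasis hφ K = slater φ K.toList := by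
  simp [slaterBasis]

lemma numberOp_univ_slaterBasis {φ : Fin L → Fin L → ℂ} (hφ : IsOrthonormalOrbitals φ)
    (K : Finset (Fin L)) :
    numberOp Finset.univ (slaterBasis hφ K) = (K.card : ℂ) • slaterBasis hφ K := by
  rw [slaterBasis_apply, slater_eigenvector (d := fun _ => 1)]
  · simp
  · ext s
    rw [numberOp_apply]
    by_cases hs : s = ∅ <;> simp [vacuum, hs]
  · intro k v
    simp only [numberOp, sum_apply, ContinuousLinearMap.comp_apply, fieldCreate_apply, map_sum,
      map_smul, one_smul, hop_create]
    rw [Finset.sum_comm, ← Finset.sum_add_distrib]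
    simp [Finset.sum_add_distrib, smul_add, Finset.smul_sum]

/-! ### Plane waves -/

/-- The primitive root of unity `e^{2πi/L}`. -/
noncomputable def chainRoot (L : ℕ) : ℂ := Complex.exp (2 * Real.pi * Complex.I / L)

/-- The plane waves `x ↦ L^{-1/2} e^{2πikx/L}`. -/
noncomputable def planeWave (L : ℕ) (k x : Fin L) : ℂ :=
  ((Real.sqrt L)⁻¹ : ℝ) * (chainRoot L ^ (k : ℕ)) ^ (x : ℕ)

lemma chainRoot_isPrimitiveRoot (hL : L ≠ 0) : IsPrimitiveRoot (chainRoot L) L :=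
  Complex.isPrimitiveRoot_exp L hL

lemma norm_chainRoot (hL : L ≠ 0) : ‖chainRoot L‖ = 1 :=
  (chainRoot_isPrimitiveRoot hL).norm'_eq_one hL

lemma norm_planeWave_sq (k x : Fin L) : ‖planeWave L k x‖ ^ 2 = (L : ℝ)⁻¹ := by
  have hL : L ≠ 0 := by have := k.isLt; lia
  rw [planeWave, norm_mul, norm_pow, norm_pow, norm_chainRoot hL, Complex.norm_real]
  simp

lemma planeWave_orthonormal (L : ℕ) : IsOrthonormalOrbitals (planeWave L) := by
  intro j k
  have hL : L ≠ 0 := by have := k.isLt; lia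
  split_ifs with hjk
  · subst hjk
    simp only [Complex.star_def, Complex.conj_mul']
    have : ∑ x, ‖planeWave L j x‖ ^ 2 = 1 := by
      simp [norm_planeWave_sq, hL]
    exact_mod_cast this
  · have hz := chainRoot_isPrimitiveRoot hL
    set w : ℂ := star (chainRoot L ^ (j : ℕ)) * chainRoot L ^ (k : ℕ) with hw
    have hinv : star (chainRoot L) = (chainRoot L)⁻¹ :=
      (Complex.inv_eq_conj (norm_chainRoot hL)).symm
    have hw1 : w ≠ 1 := by
      intro h
      rw [hw, star_pow, hinv, inv_pow, inv_mul_eq_one₀ (pow_ne_zero _ (hz.ne_zero hL))] at h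
      exact hjk (Fin.ext (hz.pow_inj j.isLt k.isLt h))
    have hwL : w ^ L = 1 := by
      rw [hw, mul_pow, ← star_pow, pow_right_comm, hz.pow_eq_one, one_pow, pow_right_comm,
        hz.pow_eq_one, one_pow, star_one, one_mul]
    have hsum : ∑ x : Fin L, w ^ (x : ℕ) = 0 := by
      rw [Fin.sum_univ_eq_sum_range (fun i => w ^ i), geom_sum_eq hw1, hwL, sub_self, zero_div]
    calc ∑ x, star (planeWave L j x) * planeWave L k x
        = ∑ x : Fin L, (((Real.sqrt L)⁻¹ : ℝ) * ((Real.sqrt L)⁻¹ : ℝ) : ℂ) * w ^ (x : ℕ) := by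
          refine Finset.sum_congr rfl fun x _ => ?_
          rw [planeWave, planeWave, star_mul', star_pow, hw, mul_pow, Complex.star_def,
            Complex.conj_ofReal]
          ring
      _ = 0 := by rw [← Finset.mul_sum, hsum, mul_zero]

lemma planeWave_finRotate (k x : Fin L) :
    planeWave L k (finRotate L x) = chainRoot L ^ (k : ℕ) * planeWave L k x := by
  obtain ⟨n, rfl⟩ : ∃ n, L = n + 1 := ⟨L - 1, by have := k.isLt; lia⟩
  have hz := chainRoot_isPrimitiveRoot (L := n + 1) (by simp)
  unfold planeWave
  rw [coe_finRotate]
  split_ifs with hx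
  · rw [hx, mul_left_comm, ← pow_succ', Fin.val_last, pow_right_comm _ (k : ℕ) (n + 1),
      hz.pow_eq_one]
    simp
  · ring

/-- The one-particle energies `2 cos(2πk/L + θ)`. -/
noncomputable def orbitalEnergy (L : ℕ) (θ : ℝ) (k : Fin L) : ℝ :=
  2 * Real.cos (2 * Real.pi * (k : ℕ) / L + θ)

lemma orbitalEnergy_eq (θ : ℝ) (k : Fin L) :
    (orbitalEnergy L θ k : ℂ) = Complex.exp (Complex.I * θ) * chainRoot L ^ (k : ℕ) +
      Complex.exp (-(Complex.I * θ)) * (chainRoot L ^ (k : ℕ))⁻¹ := by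
  rw [orbitalEnergy, chainRoot, ← Complex.exp_nat_mul, ← Complex.exp_neg, ← Complex.exp_add,
    ← Complex.exp_add]
  push_cast
  rw [Complex.two_cos]
  congr 2 <;> ring

lemma hamiltonian_fieldCreate_planeWave (θ : ℝ) (k : Fin L) (v : Fock L) :
    hamiltonian L θ (fieldCreate (planeWave L k) v) =
      fieldCreate (planeWave L k) (hamiltonian L θ v) +
        (orbitalEnergy L θ k : ℂ) • fieldCreate (planeWave L k) v := by
  have hL : L ≠ 0 := by have := k.isLt; lia
  have hz := (chainRoot_isPrimitiveRoot hL).ne_zero hL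
  have key : ∀ y z : Fin L, create y (annihilate z (fieldCreate (planeWave L k) v)) =
      fieldCreate (planeWave L k) (create y (annihilate z v)) +
        planeWave L k z • create y v := by
    intro y z
    simp only [fieldCreate_apply, map_sum, map_smul, hop_create, smul_add,
      Finset.sum_add_distrib]
    simp
  have h2 : ∑ x, planeWave L k x • create (finRotate L x) v =
      (chainRoot L ^ (k : ℕ))⁻¹ • fieldCreate (planeWave L k) v := by
    rw [fieldCreate_apply, ← Equiv.sum_comp (finRotate L) fun x => planeWave L k x • create x v,
      Finset.smul_sum]
    refine Finset.sum_congr rfl fun x _ => ?_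
    rw [planeWave_finRotate, smul_smul, inv_mul_cancel_left₀ (pow_ne_zero _ hz)]
  have h1 : ∑ x, planeWave L k (finRotate L x) • create x v =
      (chainRoot L ^ (k : ℕ)) • fieldCreate (planeWave L k) v := by
    rw [fieldCreate_apply, Finset.smul_sum]
    refine Finset.sum_congr rfl fun x _ => ?_
    rw [planeWave_finRotate, smul_smul]
  simp only [hamiltonian, sum_apply, add_apply, smul_apply,
    ContinuousLinearMap.comp_apply, key, smul_add, map_sum, map_add, map_smul,
    Finset.sum_add_distrib]
  rw [← Finset.smul_sum (f := fun x => planeWave L k (finRotate L x) • create x v), h1,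
    ← Finset.smul_sum (f := fun x => planeWave L k x • create (finRotate L x) v), h2,
    orbitalEnergy_eq, add_smul, smul_smul, smul_smul]
  abel

/-- The orthonormal basis of energy eigenstates. -/
noncomputable def energyBasis (L : ℕ) : OrthonormalBasis (Finset (Fin L)) ℂ (Fock L) :=
  slaterBasis (planeWave_orthonormal L)

/-- The energy of an eigenstate. -/
noncomputable def energy (L : ℕ) (θ : ℝ) (K : Finset (Fin L)) : ℝ :=
  ∑ k ∈ K, orbitalEnergy L θ k

lemma hamiltonian_energyBasis (θ : ℝ) (K : Finset (Fin L)) :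
    hamiltonian L θ (energyBasis L K) = (energy L θ K : ℂ) • energyBasis L K := by
  rw [energyBasis, slaterBasis_apply,
    slater_eigenvector (d := fun k => (orbitalEnergy L θ k : ℂ)) _
      (hamiltonian_fieldCreate_planeWave θ), Finset.sum_map_toList, energy]
  · push_cast; rfl
  · simp [hamiltonian, annihilate_vacuum]

/-! ### Large deviations of the particle number in Slater determinants -/

/-- The operator that multiplies the basis vector of `s` by `∏_{x ∈ s} w(x)`. -/
noncomputable def reweight (w : Fin L → ℝ) : Fock L →ₗ[ℂ] Fock L where
  toFun v := WithLp.toLp 2 fun s => ((∏ x ∈ s, w x : ℝ) : ℂ) * v s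
  map_add' v v' := by ext s; simp [mul_add]
  map_smul' c v := by ext s; simp [mul_left_comm]

lemma reweight_apply (w : Fin L → ℝ) (v : Fock L) (s : Finset (Fin L)) :
    reweight w v s = ((∏ x ∈ s, w x : ℝ) : ℂ) * v s := rfl

lemma reweight_create (w : Fin L → ℝ) (x : Fin L) (v : Fock L) :
    reweight w (create x v) = (w x : ℂ) • create x (reweight w v) := by
  ext s
  simp only [reweight_apply, PiLp.smul_apply, create_apply, smul_eq_mul]
  split_ifs with hx
  · rw [← Finset.mul_prod_erase s w hx]
    push_cast
    ring
  · simp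

lemma reweight_fieldCreate (w : Fin L → ℝ) (f : Fin L → ℂ) (v : Fock L) :
    reweight w (fieldCreate f v) = fieldCreate (fun x => w x * f x) (reweight w v) := by
  simp only [fieldCreate_apply, map_sum, map_smul, reweight_create, smul_smul, mul_comm]

/-- Reweighting turns the orbitals `φ k` into `w φ k`, which are in general no longer orthogonal,
and each creation multiplies the norm by at most that of its orbital. This is Hadamard's inequality
for the Gram determinant. -/
lemma norm_sq_reweight_slater_le (w : Fin L → ℝ) (φ : Fin L → Fin L → ℂ) (l : List (Fin L)) :
    ‖reweight w (slater φ l)‖ ^ 2 ≤ (l.map fun k => ∑ x, w x ^ 2 * ‖φ k x‖ ^ 2).prod := by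
  induction l with
  | nil =>
    have : reweight w (vacuum L) = vacuum L := by
      ext s
      rw [reweight_apply]
      by_cases hs : s = ∅ <;> simp [vacuum, hs]
    simp only [slater, List.foldr_nil, this]
    simp [vacuum]
  | cons k l ih =>
    rw [slater_cons, reweight_fieldCreate, List.map_cons, List.prod_cons]
    refine (norm_sq_fieldCreate_le _ _).trans ?_
    have : ∑ x, ‖(w x : ℂ) * φ k x‖ ^ 2 = ∑ x, w x ^ 2 * ‖φ k x‖ ^ 2 := by
      simp [mul_pow]
    rw [this]
    gcongr

lemma norm_sq_reweight (w : Fin L → ℝ) (v : Fock L) :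
    ‖reweight w v‖ ^ 2 = ∑ s, (∏ x ∈ s, w x ^ 2) * ‖v s‖ ^ 2 := by
  rw [EuclideanSpace.norm_sq_eq]
  refine Finset.sum_congr rfl fun s _ => ?_
  rw [reweight_apply, norm_mul, mul_pow, Complex.norm_real, Real.norm_eq_abs, sq_abs,
    Finset.prod_pow]

/-- Reweight by `e^{a/2}` on `S` and by `1` elsewhere. As `‖planeWave L k x‖² = 1/L`, all orbitals
contribute the same factor. -/
lemma sum_exp_mul_norm_sq_energyBasis_le (S K : Finset (Fin L)) (a : ℝ) :
    ∑ s, Real.exp (a * (S ∩ s).card) * ‖energyBasis L K s‖ ^ 2 ≤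
      (1 - (S.card : ℝ) / L + S.card / L * Real.exp a) ^ K.card := by
  rcases eq_or_ne L 0 with rfl | hL
  · have hK : K = ∅ := Subsingleton.elim _ _
    have h := (energyBasis 0).norm_eq_one K
    have h2 : ∑ s, ‖energyBasis 0 K s‖ ^ 2 = 1 := by
      rw [← EuclideanSpace.norm_sq_eq, h, one_pow]
    have hS : ∀ s : Finset (Fin 0), S ∩ s = ∅ := fun s => Subsingleton.elim _ _
    simpa [hS, hK] using h2.le
  have h := norm_sq_reweight_slater_le (fun x => if x ∈ S then Real.exp (a / 2) else 1)
    (planeWave L) K.toList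
  rw [← slaterBasis_apply (planeWave_orthonormal L), ← energyBasis, norm_sq_reweight] at h
  have he : Real.exp (a / 2) ^ 2 = Real.exp a := by
    rw [← Real.exp_nat_mul]; congr 1; push_cast; ring
  have h1 : ∀ s : Finset (Fin L), ∏ x ∈ s, (if x ∈ S then Real.exp (a / 2) else 1) ^ 2 =
      Real.exp (a * (S ∩ s).card) := by
    intro s
    simp only [ite_pow, he, one_pow]
    rw [← Finset.prod_filter, Finset.prod_const, ← Real.exp_nat_mul, mul_comm,
      Finset.filter_mem_eq_inter, Finset.inter_comm]
  have h2 : ∀ k : Fin L, ∑ x, (if x ∈ S then Real.exp (a / 2) else 1) ^ 2 *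
      ‖planeWave L k x‖ ^ 2 = 1 - (S.card : ℝ) / L + S.card / L * Real.exp a := by
    intro k
    simp only [norm_planeWave_sq, ← Finset.sum_mul, ite_pow, he, one_pow]
    rw [Finset.sum_ite, Finset.sum_const, Finset.sum_const, Finset.filter_notMem_eq_sdiff,
      Finset.filter_mem_eq_inter, Finset.univ_inter, Finset.card_sdiff_of_subset (Finset.subset_univ S),
      Finset.card_univ, Fintype.card_fin, nsmul_eq_mul, nsmul_eq_mul,
      Nat.cast_sub (by simpa using Finset.card_le_univ S)]
    field_simp
    ring
  simpa only [h1, h2, List.map_const', List.prod_replicate, Finset.length_toList] using h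

lemma chernoff_energyBasis (S K : Finset (Fin L)) (a c : ℝ) :
    ∑ s with c ≤ a * (S ∩ s).card, ‖energyBasis L K s‖ ^ 2 ≤
      Real.exp (-c) * (1 - (S.card : ℝ) / L + S.card / L * Real.exp a) ^ K.card := by
  rw [Real.exp_neg, inv_mul_eq_div, le_div_iff₀ (Real.exp_pos c), Finset.sum_mul]
  refine le_trans ?_ (sum_exp_mul_norm_sq_energyBasis_le S K a)
  refine (Finset.sum_le_sum fun s hs => ?_).trans (Finset.sum_le_sum_of_subset_of_nonneg
    (Finset.filter_subset (fun s => c ≤ a * (S ∩ s).card) Finset.univ)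
    fun s _ _ => by positivity)
  rw [mul_comm]
  gcongr
  exact (Finset.mem_filter.mp hs).2

lemma card_leftHalf (L : ℕ) : (leftHalf L).card = (L - 1) / 2 := by
  rw [leftHalf, Fin.card_filter_val_lt]
  lia

lemma moment_leftHalf_le (hL : Odd L) (a : ℝ) :
    1 - ((leftHalf L).card : ℝ) / L + (leftHalf L).card / L * Real.exp a ≤
      Real.exp (a / 2 + a ^ 2 / 8 + 1 / L) := by
  obtain ⟨m, rfl⟩ := hL
  have hm : (leftHalf (2 * m + 1)).card = m := by rw [card_leftHalf]; lia
  have hpos : (0 : ℝ) < ((2 * m + 1 : ℕ) : ℝ) := by positivity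
  -- The left half has the fraction `(1 - 1/L)/2` of the sites; the deficit from `1/2` produces the
  -- `sinh` term and finally the `1/L` in the exponent.
  have h1 : 1 - (m : ℝ) / (2 * m + 1 : ℕ) + m / (2 * m + 1 : ℕ) * Real.exp a =
      Real.exp (a / 2) * (Real.cosh (a / 2) - Real.sinh (a / 2) * (1 / (2 * m + 1 : ℕ))) := by
    have h2 : Real.exp a = Real.exp (a / 2) * Real.exp (a / 2) := by
      rw [← Real.exp_add, add_halves]
    have h3 : Real.exp (a / 2) * Real.exp (-(a / 2)) = 1 := by
      rw [← Real.exp_add, add_neg_cancel, Real.exp_zero]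
    rw [Real.cosh_eq, Real.sinh_eq, h2]
    field_simp
    push_cast
    linear_combination (-(2 * m + 1) - 1 : ℝ) * h3
  have h4 : Real.cosh (a / 2) - Real.sinh (a / 2) * (1 / (2 * m + 1 : ℕ)) ≤
      Real.cosh (a / 2) * (1 / (2 * m + 1 : ℕ) + 1) := by
    have h5 : 0 ≤ (Real.cosh (a / 2) + Real.sinh (a / 2)) * (1 / (2 * m + 1 : ℕ)) := by
      rw [Real.cosh_add_sinh]; positivity
    linarith
  rw [hm, h1, Real.exp_add, Real.exp_add, mul_assoc]
  gcongr
  refine h4.trans ?_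
  gcongr
  · exact (Real.cosh_le_exp_half_sq _).trans (le_of_eq (by ring_nf))
  · exact Real.add_one_le_exp _

/-- In every energy eigenstate the distribution of the particles between the two halves of the
chain is close to balanced. -/
lemma unbalanced_energyBasis_le (hL : Odd L) {N : ℕ} (hN : 0 < N) {ρ : ℝ} (hρ : ρ = (N : ℝ) / L)
    (hρ5 : ρ ≤ 1 / 5) {K : Finset (Fin L)} (hK : K.card = N) :
    ∑ s with ¬ |((leftHalf L ∩ s).card : ℝ) / N - 1 / 2| ≤ Real.sqrt (3 / 2 * ρ),
      ‖energyBasis L K s‖ ^ 2 ≤ 3 * Real.exp (-(3 * ρ * N)) := by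
  set δ := Real.sqrt (3 / 2 * ρ) with hδ
  have hN' : (0 : ℝ) < N := by exact_mod_cast hN
  have hρ0 : 0 ≤ ρ := by rw [hρ]; positivity
  have hδ2 : δ ^ 2 = 3 / 2 * ρ := Real.sq_sqrt (by positivity)
  have hδ0 : 0 ≤ δ := Real.sqrt_nonneg _
  -- `a = ±4δ` is Hoeffding's optimal tilt for the two tails. The exponent becomes `-2δ²N + N/L =
  -- -3ρN + ρ`, and `e^ρ ≤ e^{1/5} ≤ 3/2` absorbs the correction.
  have key : ∀ a c : ℝ, c = a * N / 2 + 4 * δ ^ 2 * N → a ^ 2 = 16 * δ ^ 2 →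
      ∑ s with c ≤ a * (leftHalf L ∩ s).card, ‖energyBasis L K s‖ ^ 2 ≤
        3 / 2 * Real.exp (-(3 * ρ * N)) := by
    intro a c hc ha
    refine (chernoff_energyBasis _ _ _ _).trans ?_
    have h1 : 0 ≤ 1 - ((leftHalf L).card : ℝ) / L + (leftHalf L).card / L * Real.exp a := by
      have : ((leftHalf L).card : ℝ) / L ≤ 1 := by
        refine div_le_one_of_le₀ ?_ (by positivity)
        have := Finset.card_le_univ (leftHalf L)
        rw [Fintype.card_fin] at this
        exact_mod_cast this
      have : 0 ≤ ((leftHalf L).card : ℝ) / L * Real.exp a := by positivity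
      linarith
    have h2 := pow_le_pow_left₀ h1 (moment_leftHalf_le hL a) K.card
    rw [hK, ← Real.exp_nat_mul] at h2
    have h3 : Real.exp (1 / 5) ≤ 3 / 2 := by
      have := Real.exp_bound_div_one_sub_of_interval (x := 1 / 5) (by norm_num) (by norm_num)
      linarith
    rw [hK]
    calc _ ≤ Real.exp (-c) * Real.exp (N * (a / 2 + a ^ 2 / 8 + 1 / L)) := by gcongr
      _ = Real.exp ρ * Real.exp (-(3 * ρ * N)) := by
        rw [← Real.exp_add, ← Real.exp_add, hc, ha, hδ2, hρ]
        congr 1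
        ring
      _ ≤ Real.exp (1 / 5) * Real.exp (-(3 * ρ * N)) := by gcongr
      _ ≤ _ := by gcongr
  have h1 := key (4 * δ) _ rfl (by ring)
  have h2 := key (-(4 * δ)) _ rfl (by ring)
  have hsub : (Finset.univ.filter fun s : Finset (Fin L) =>
      ¬ |((leftHalf L ∩ s).card : ℝ) / N - 1 / 2| ≤ δ) ⊆
      (Finset.univ.filter fun s : Finset (Fin L) =>
        4 * δ * N / 2 + 4 * δ ^ 2 * N ≤ 4 * δ * (leftHalf L ∩ s).card) ∪
      (Finset.univ.filter fun s : Finset (Fin L) =>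
        -(4 * δ) * N / 2 + 4 * δ ^ 2 * N ≤ -(4 * δ) * (leftHalf L ∩ s).card) := by
    intro s hs
    simp only [Finset.mem_union, Finset.mem_filter, Finset.mem_univ, true_and, not_le] at hs ⊢
    rcases lt_abs.mp hs with h | h
    · left
      have h3 : δ + 1 / 2 ≤ ((leftHalf L ∩ s).card : ℝ) / N := by linarith
      rw [le_div_iff₀ hN'] at h3
      nlinarith
    · right
      have h3 : ((leftHalf L ∩ s).card : ℝ) / N ≤ 1 / 2 - δ := by linarith
      rw [div_le_iff₀ hN'] at h3
      nlinarith
  have h3 := (Finset.sum_le_sum_of_subset_of_nonneg hsub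
    fun s _ _ => sq_nonneg ‖energyBasis L K s‖)
  have h4 := Finset.sum_union_inter (s₁ := Finset.univ.filter fun s : Finset (Fin L) =>
        4 * δ * N / 2 + 4 * δ ^ 2 * N ≤ 4 * δ * (leftHalf L ∩ s).card)
    (s₂ := Finset.univ.filter fun s : Finset (Fin L) =>
        -(4 * δ) * N / 2 + 4 * δ ^ 2 * N ≤ -(4 * δ) * (leftHalf L ∩ s).card)
    (f := fun s => ‖energyBasis L K s‖ ^ 2)
  have h5 := Finset.sum_nonneg (s := (Finset.univ.filter fun s : Finset (Fin L) =>
        4 * δ * N / 2 + 4 * δ ^ 2 * N ≤ 4 * δ * (leftHalf L ∩ s).card) ∩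
    (Finset.univ.filter fun s : Finset (Fin L) =>
        -(4 * δ) * N / 2 + 4 * δ ^ 2 * N ≤ -(4 * δ) * (leftHalf L ∩ s).card))
    fun s _ => sq_nonneg ‖energyBasis L K s‖
  linarith

/-! ### Time evolution and time averages -/

lemma exp_apply_eigenvector {E : Type*} [NormedAddCommGroup E] [NormedSpace ℂ E] [CompleteSpace E]
    {A : E →L[ℂ] E} {a : ℂ} {v : E} (h : A v = a • v) :
    NormedSpace.exp A v = Complex.exp a • v := by
  have hpow : ∀ n : ℕ, (A ^ n) v = a ^ n • v := by
    intro n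
    induction n with
    | zero => simp
    | succ n ih => rw [pow_succ, mul_apply_eq_comp, h, map_smul, ih, smul_smul,
        mul_comm, pow_succ]
  have h1 := (NormedSpace.exp_series_hasSum_exp' (𝕂 := ℂ) A).mapL
    (ContinuousLinearMap.apply ℂ E v)
  have h2 := (NormedSpace.exp_series_hasSum_exp' (𝕂 := ℂ) a).smul_const v
  rw [← Complex.exp_eq_exp_ℂ] at h2
  refine (HasSum.unique ?_ h1).symm
  simpa [hpow, smul_smul] using h2

lemma evolution_energyBasis (θ t : ℝ) (K : Finset (Fin L)) :
    evolution L θ t (energyBasis L K) =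
      Complex.exp (-(Complex.I * t) * energy L θ K) • energyBasis L K := by
  refine exp_apply_eigenvector ?_
  rw [smul_apply, hamiltonian_energyBasis, smul_smul]

lemma evolution_apply (θ t : ℝ) (v : Fock L) :
    evolution L θ t v = ∑ K, (inner ℂ (energyBasis L K) v *
      Complex.exp (-(Complex.I * t) * energy L θ K)) • energyBasis L K := by
  conv_lhs => rw [← (energyBasis L).sum_repr' v]
  simp only [map_sum, map_smul, evolution_energyBasis, smul_smul]

lemma norm_evolution_phase (t e : ℝ) : ‖Complex.exp (-(Complex.I * t) * e)‖ = 1 := by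
  have : -(Complex.I * t) * e = ((-(t * e) : ℝ) : ℂ) * Complex.I := by push_cast; ring
  rw [this, Complex.norm_exp_ofReal_mul_I]

lemma norm_sq_evolution (θ t : ℝ) (v : Fock L) : ‖evolution L θ t v‖ ^ 2 = ‖v‖ ^ 2 := by
  rw [← (energyBasis L).sum_sq_norm_inner_right, ← (energyBasis L).sum_sq_norm_inner_right v]
  refine Finset.sum_congr rfl fun K _ => ?_
  rw [evolution_apply, (energyBasis L).orthonormal.inner_right_fintype, norm_mul,
    norm_evolution_phase, mul_one]

lemma tendsto_average_exp (ω : ℝ) :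
    Filter.Tendsto (fun T : ℝ => (T : ℂ)⁻¹ * ∫ t in (0 : ℝ)..T, Complex.exp (Complex.I * ω * t))
      Filter.atTop (nhds (if ω = 0 then 1 else 0)) := by
  split_ifs with hω
  · subst hω
    refine tendsto_const_nhds.congr' ?_
    filter_upwards [Filter.eventually_gt_atTop 0] with T hT
    have : (T : ℂ) ≠ 0 := by exact_mod_cast hT.ne'
    simp [this]
  · have hc : Complex.I * ω ≠ 0 := mul_ne_zero Complex.I_ne_zero (by exact_mod_cast hω)
    have hlim : Filter.Tendsto (fun T : ℝ => T⁻¹ * (2 / |ω|)) Filter.atTop (nhds 0) := by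
      simpa using tendsto_inv_atTop_zero.mul_const (2 / |ω|)
    refine squeeze_zero_norm' ?_ hlim
    filter_upwards [Filter.eventually_gt_atTop 0] with T hT
    rw [integral_exp_mul_complex hc, norm_mul, norm_inv, norm_div, norm_mul, Complex.norm_I,
      one_mul, Complex.norm_real, Complex.norm_real, Real.norm_eq_abs, Real.norm_eq_abs,
      abs_of_pos hT]
    gcongr
    refine (norm_sub_le _ _).trans (le_of_eq ?_)
    have h : ∀ t : ℝ, ‖Complex.exp (Complex.I * ω * t)‖ = 1 := by
      intro t
      have : Complex.I * ω * t = ((ω * t : ℝ) : ℂ) * Complex.I := by push_cast; ring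
      rw [this, Complex.norm_exp_ofReal_mul_I]
    rw [h, h]
    norm_num

/-- Expand the square into a double sum of phases with frequencies `E j - E k`; by injectivity only
the diagonal terms have zero frequency. -/
lemma tendsto_average_norm_sq {ι : Type*} (J : Finset ι) (a : ι → ℂ) (E : ι → ℝ)
    (hE : Set.InjOn E J) :
    Filter.Tendsto (fun T : ℝ => T⁻¹ * ∫ t in (0 : ℝ)..T,
        ‖∑ j ∈ J, a j * Complex.exp (-(Complex.I * t) * E j)‖ ^ 2)
      Filter.atTop (nhds (∑ j ∈ J, ‖a j‖ ^ 2)) := by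
  classical
  have hexp : ∀ t : ℝ, ((‖∑ j ∈ J, a j * Complex.exp (-(Complex.I * t) * E j)‖ ^ 2 : ℝ) : ℂ) =
      ∑ j ∈ J, ∑ k ∈ J, star (a j) * a k *
        Complex.exp (Complex.I * ((E j - E k : ℝ) : ℂ) * t) := by
    intro t
    rw [Complex.ofReal_pow, ← Complex.conj_mul', map_sum, Finset.sum_mul_sum]
    refine Finset.sum_congr rfl fun j _ => Finset.sum_congr rfl fun k _ => ?_
    rw [map_mul, ← Complex.exp_conj, mul_mul_mul_comm, ← Complex.exp_add]
    congr 2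
    simp
    ring
  have hlim : Filter.Tendsto (fun T : ℝ => ∑ j ∈ J, ∑ k ∈ J, star (a j) * a k *
      ((T : ℂ)⁻¹ * ∫ t in (0 : ℝ)..T, Complex.exp (Complex.I * ((E j - E k : ℝ) : ℂ) * t)))
      Filter.atTop (nhds (∑ j ∈ J, ∑ k ∈ J, star (a j) * a k *
        (if E j - E k = 0 then 1 else 0))) :=
    tendsto_finsetSum _ fun j _ => tendsto_finsetSum _ fun k _ =>
      (tendsto_average_exp _).const_mul _
  have hval : ∑ j ∈ J, ∑ k ∈ J, star (a j) * a k * (if E j - E k = 0 then 1 else 0) =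
      ((∑ j ∈ J, ‖a j‖ ^ 2 : ℝ) : ℂ) := by
    push_cast
    refine Finset.sum_congr rfl fun j hj => ?_
    rw [Finset.sum_eq_single j]
    · simp [Complex.conj_mul']
    · intro k hk hkj
      rw [if_neg, mul_zero]
      exact fun h => hkj (hE hk hj (sub_eq_zero.mp h).symm)
    · exact fun h => absurd hj h
  rw [hval] at hlim
  refine ((Complex.continuous_re.tendsto _).comp hlim).congr fun T => ?_
  rw [Function.comp_apply, ← Complex.ofReal_re (T⁻¹ * _)]
  congr 1
  rw [Complex.ofReal_mul, ← intervalIntegral.integral_ofReal]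
  simp only [hexp]
  rw [intervalIntegral.integral_finsetSum
    fun j _ => Continuous.intervalIntegrable (by fun_prop) _ _, Finset.mul_sum, Complex.ofReal_inv]
  refine Finset.sum_congr rfl fun j _ => ?_
  rw [intervalIntegral.integral_finsetSum
    fun j _ => Continuous.intervalIntegrable (by fun_prop) _ _, Finset.mul_sum]
  refine Finset.sum_congr rfl fun k _ => ?_
  rw [intervalIntegral.integral_const_mul]
  ring

/-- An open set may have infinitely many components, so it is first approximated from inside by a
compact set, which finitely many balls cover. -/
lemma exists_finite_union_of_intervals {U : Set ℝ} (hU : IsOpen U) {r : ENNReal}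
    (hr : r < volume U) : ∃ G ⊆ U, IsFiniteUnionOfIntervals G ∧ r < volume G := by
  obtain ⟨K, hKU, hK, hrK⟩ := hU.exists_lt_isCompact hr
  have hball : ∀ x ∈ K, ∃ ε > 0, Metric.ball x ε ⊆ U := fun x hx =>
    Metric.isOpen_iff.mp hU x (hKU hx)
  choose! ε hε hεU using hball
  obtain ⟨F, hFK, hF⟩ := hK.elim_nhds_subcover (fun x => Metric.ball x (ε x))
    fun x hx => Metric.ball_mem_nhds x (hε x hx)
  refine ⟨⋃ x ∈ F, Metric.ball x (ε x), Set.iUnion₂_subset fun x hx => hεU x (hFK x hx), ?_,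
    hrK.trans_le (measure_mono hF)⟩
  refine ⟨(fun x => Metric.ball x (ε x)) '' F, F.finite_toSet.image _, ?_, ?_⟩
  · rintro _ ⟨x, _, rfl⟩
    simp only [Real.ball_eq_Ioo]
    exact Set.ordConnected_Ioo
  · simp [Set.sUnion_image]

lemma exists_intervals_of_average_lt {q : ℝ → ℝ} (hq : Continuous q) (hq0 : ∀ t, 0 ≤ q t)
    {T ε η : ℝ} (hT : 0 < T) (hε : 0 < ε) (havg : T⁻¹ * ∫ t in (0 : ℝ)..T, q t < ε * η) :
    ∃ G ⊆ Set.Icc 0 T, IsFiniteUnionOfIntervals G ∧ 1 - η ≤ volume.real G / T ∧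
      ∀ t ∈ G, q t < ε := by
  have hopen : IsOpen (Set.Ioo 0 T ∩ {t | q t < ε}) :=
    isOpen_Ioo.inter (isOpen_lt hq continuous_const)
  have hmeas : MeasurableSet {t | q t < ε} := (isOpen_lt hq continuous_const).measurableSet
  have hmarkov : ε * volume.real (Set.Ioo 0 T \ {t | q t < ε}) ≤ ∫ t in (0 : ℝ)..T, q t := by
    have h := mul_meas_ge_le_integral_of_nonneg (μ := volume.restrict (Set.Ioo 0 T)) (f := q)
      (Filter.Eventually.of_forall hq0)
      ((hq.integrableOn_Icc (a := 0) (b := T)).mono_set Set.Ioo_subset_Icc_self) ε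
    rw [intervalIntegral.integral_of_le hT.le, ← integral_Ioc_eq_integral_Ioo.symm]
    rw [measureReal_restrict_apply (measurableSet_le measurable_const hq.measurable)] at h
    refine le_trans (le_of_eq ?_) h
    congr 2
    ext t
    simp [and_comm]
  have hsplit := measureReal_inter_add_sdiff (μ := volume) (s := Set.Ioo 0 T)
    (t := {t | q t < ε}) hmeas (by simp)
  rw [Real.volume_real_Ioo_of_le hT.le, sub_zero] at hsplit
  have hlt : T * (1 - η) < volume.real (Set.Ioo 0 T ∩ {t | q t < ε}) := by
    rw [inv_mul_lt_iff₀ hT] at havg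
    have : ε * volume.real (Set.Ioo 0 T \ {t | q t < ε}) < ε * (T * η) := by
      refine hmarkov.trans_lt (havg.trans_eq ?_)
      ring
    have := lt_of_mul_lt_mul_left this hε.le
    linarith
  have hfin : volume (Set.Ioo 0 T ∩ {t | q t < ε}) ≠ ⊤ :=
    ((measure_mono Set.inter_subset_left).trans_lt (by simp)).ne
  -- `ENNReal.ofReal` would truncate a negative `1 - η`; in that case the empty set suffices.
  rcases le_or_gt 0 (1 - η) with hη | hη
  · obtain ⟨G, hGU, hG, hGm⟩ := exists_finite_union_of_intervals hopen
      (r := ENNReal.ofReal (T * (1 - η)))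
      ((ENNReal.ofReal_lt_iff_lt_toReal (mul_nonneg hT.le hη) hfin).mpr hlt)
    refine ⟨G, fun t ht => Set.Ioo_subset_Icc_self (hGU ht).1, hG, ?_, fun t ht => (hGU ht).2⟩
    rw [le_div_iff₀ hT, mul_comm]
    exact ((ENNReal.ofReal_lt_iff_lt_toReal (mul_nonneg hT.le hη)
      (measure_ne_top_of_subset hGU hfin)).mp hGm).le
  · exact ⟨∅, by simp, ⟨∅, by simp⟩, by simpa using hη.le, by simp⟩

/-! ### Measurements -/

/-- Deleting the coordinates of `v` with counts outside `B` leaves a vector `w` of the spectral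
subspace, and the projection of `v` is at least as close to `v` as `w` is. -/
lemma norm_sq_sub_le_measureProb (S : Finset (Fin L)) (B : Set ℝ)
    [DecidablePred fun s : Finset (Fin L) => ¬ ((S ∩ s).card : ℝ) ∈ B] (v : Fock L) :
    ‖v‖ ^ 2 - ∑ s with ¬ ((S ∩ s).card : ℝ) ∈ B, ‖v s‖ ^ 2 ≤ measureProb (numberOp S) B v := by
  classical
  set w : Fock L := WithLp.toLp 2 fun s => if ((S ∩ s).card : ℝ) ∈ B then v s else 0 with hw
  have hwmem : w ∈ spectralSubspace (numberOp S) B := by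
    have : w = ∑ s, w s • EuclideanSpace.single s (1 : ℂ) := by
      ext s
      simp [Pi.single_apply]
    rw [this]
    refine Submodule.sum_mem _ fun s _ => ?_
    by_cases hs : ((S ∩ s).card : ℝ) ∈ B
    · refine Submodule.smul_mem _ _ (Submodule.mem_iSup_of_mem _ (Submodule.mem_iSup_of_mem hs ?_))
      rw [mem_eigenspace_numberOp]
      intro s' hs'
      have : s' = s := by
        by_contra h
        simp [h] at hs'
      rw [this]
      norm_cast
    · simp [hw, hs]
  have hpyth := Submodule.norm_sq_eq_add_norm_sq_starProjection v (spectralSubspace (numberOp S) B)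
  have hmin : ‖(spectralSubspace (numberOp S) B)ᗮ.starProjection v‖ ≤ ‖v - w‖ := by
    have h : (spectralSubspace (numberOp S) B)ᗮ.starProjection v =
        (spectralSubspace (numberOp S) B)ᗮ.starProjection (v - w) := by
      rw [map_sub, (Submodule.starProjection_apply_eq_zero_iff _ (v := w)).mpr, sub_zero]
      exact Submodule.le_orthogonal_orthogonal _ hwmem
    rw [h]
    exact Submodule.norm_starProjection_apply_le _ _
  have hvw : ‖v - w‖ ^ 2 = ∑ s with ¬ ((S ∩ s).card : ℝ) ∈ B, ‖v s‖ ^ 2 := by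
    rw [EuclideanSpace.norm_sq_eq, Finset.sum_filter]
    refine Finset.sum_congr rfl fun s _ => ?_
    by_cases hs : ((S ∩ s).card : ℝ) ∈ B <;> simp [hw, hs]
  have := pow_le_pow_left₀ (norm_nonneg _) hmin 2
  rw [measureProb]
  linarith

/-! ### Nondegeneracy -/

/-- Compare the `i`-th coordinates of `D v` and `a • v`. Applied to both the particle number and the
Hamiltonian. -/
lemma inner_basis_ne_zero_imp {ι E : Type*} [Fintype ι] [NormedAddCommGroup E]
    [InnerProductSpace ℂ E] (b : OrthonormalBasis ι ℂ E) {D : E →L[ℂ] E} {d : ι → ℂ}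
    (hD : ∀ i, D (b i) = d i • b i) {a : ℂ} {v : E} (hv : D v = a • v) {i : ι}
    (hi : inner ℂ (b i) v ≠ 0) : d i = a := by
  have h : D v = ∑ j, (inner ℂ (b j) v * d j) • b j := by
    conv_lhs => rw [← b.sum_repr' v]
    simp only [map_sum, map_smul, hD, smul_smul]
  have h2 := congrArg (fun w => inner ℂ (b i) w) (h.symm.trans hv)
  simp only [b.orthonormal.inner_right_fintype, inner_smul_right] at h2
  rw [mul_comm] at h2
  exact mul_right_cancel₀ hi h2

lemma numberOp_univ_energyBasis (K : Finset (Fin L)) :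
    numberOp Finset.univ (energyBasis L K) = (K.card : ℂ) • energyBasis L K :=
  numberOp_univ_slaterBasis _ K

lemma energyBasis_mem_sector (K : Finset (Fin L)) : energyBasis L K ∈ sector L K.card :=
  Module.End.mem_eigenspace_iff.mpr (numberOp_univ_energyBasis K)

lemma card_eq_of_mem_sector {N : ℕ} {v : Fock L} (hv : v ∈ sector L N) {K : Finset (Fin L)}
    (hK : inner ℂ (energyBasis L K) v ≠ 0) : K.card = N := by
  exact_mod_cast inner_basis_ne_zero_imp (energyBasis L) numberOp_univ_energyBasis
    (Module.End.mem_eigenspace_iff.mp hv) hK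

/-- Two sets with the same energy would put two orthonormal vectors into a space of dimension at
most one. Conversely, a vector of the joint eigenspace is supported on the basis states with
matching energy and particle number, of which there is at most one. -/
lemma nondegenerate_iff {N : ℕ} {θ : ℝ} :
    Nondegenerate L N θ ↔ Set.InjOn (energy L θ) {K | K.card = N} := by
  constructor
  · intro h K hK K' hK' hE
    by_contra hne
    have hmem : ∀ M : Finset (Fin L), M.card = N → energy L θ M = energy L θ K →
        energyBasis L M ∈ sector L N ⊓ eigenspace (hamiltonian L θ) (energy L θ K) := by
      intro M hM hEM
      refine ⟨hM ▸ energyBasis_mem_sector M, Module.End.mem_eigenspace_iff.mpr ?_⟩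
      rw [← hEM]
      exact hamiltonian_energyBasis θ M
    obtain ⟨v, hv⟩ := finrank_le_one_iff.mp (h (energy L θ K))
    obtain ⟨c, hc⟩ := hv ⟨_, hmem K hK rfl⟩
    obtain ⟨c', hc'⟩ := hv ⟨_, hmem K' hK' hE.symm⟩
    have h1 : c • (v : Fock L) = energyBasis L K := congrArg Subtype.val hc
    have h2 : c' • (v : Fock L) = energyBasis L K' := congrArg Subtype.val hc'
    have h0 := (energyBasis L).inner_eq_zero hne
    have hn := (energyBasis L).norm_eq_one K
    have hn' := (energyBasis L).norm_eq_one K'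
    rw [← h1, ← h2, inner_smul_left, inner_smul_right] at h0
    rw [← h1] at hn
    rw [← h2] at hn'
    have hc0 : c ≠ 0 := by rintro rfl; simp at hn
    have hc0' : c' ≠ 0 := by rintro rfl; simp at hn'
    have hv0 : (v : Fock L) ≠ 0 := by intro h; simp [h] at hn
    simp [hc0, hc0', hv0] at h0
  · intro h E
    by_cases hex : ∃ K : Finset (Fin L), K.card = N ∧ (energy L θ K : ℂ) = E
    · obtain ⟨K, hK, rfl⟩ := hex
      refine finrank_le_one ⟨energyBasis L K, hK ▸ energyBasis_mem_sector K,
        Module.End.mem_eigenspace_iff.mpr (hamiltonian_energyBasis θ K)⟩ fun w => ?_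
      refine ⟨inner ℂ (energyBasis L K) (w : Fock L), Subtype.ext ?_⟩
      rw [← (energyBasis L).sum_repr' (w : Fock L), Finset.sum_eq_single K]
      · simp
      · intro M _ hM
        by_contra hne
        have hi : inner ℂ (energyBasis L M) (w : Fock L) ≠ 0 := fun h0 => hne (by rw [h0, zero_smul])
        have hE := inner_basis_ne_zero_imp (energyBasis L) (hamiltonian_energyBasis θ)
          (Module.End.mem_eigenspace_iff.mp w.2.2) hi
        exact hM (h (card_eq_of_mem_sector w.2.1 hi) hK (by exact_mod_cast hE))
      · simp
    · refine finrank_le_one 0 fun w => ⟨0, Subtype.ext ?_⟩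
      rw [← (energyBasis L).sum_repr' (w : Fock L), Finset.sum_eq_zero]
      · simp
      · intro M _
        by_contra hne
        have hi : inner ℂ (energyBasis L M) (w : Fock L) ≠ 0 := fun h0 => hne (by rw [h0, zero_smul])
        exact hex ⟨M, card_eq_of_mem_sector w.2.1 hi, inner_basis_ne_zero_imp (energyBasis L)
          (hamiltonian_energyBasis θ) (Module.End.mem_eigenspace_iff.mp w.2.2) hi⟩

/-! ### Thermalization -/

lemma evolution_coordinate {N : ℕ} (θ t : ℝ) {v : Fock L} (hv : v ∈ sector L N)
    (s : Finset (Fin L)) :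
    evolution L θ t v s = ∑ K with K.card = N, inner ℂ (energyBasis L K) v * energyBasis L K s *
      Complex.exp (-(Complex.I * t) * energy L θ K) := by
  rw [evolution_apply, WithLp.ofLp_sum, Finset.sum_apply, Finset.sum_filter]
  refine Finset.sum_congr rfl fun K _ => ?_
  rw [PiLp.smul_apply, smul_eq_mul]
  split_ifs with hK
  · ring
  · have : inner ℂ (energyBasis L K) v = 0 := by
      by_contra h
      exact hK (card_eq_of_mem_sector hv h)
    rw [this, zero_mul, zero_mul]

lemma tendsto_average_unbalanced {N : ℕ} {θ : ℝ} (hθ : Nondegenerate L N θ) {v : Fock L}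
    (hv : v ∈ sector L N) (Z : Finset (Finset (Fin L))) :
    Filter.Tendsto (fun T : ℝ => T⁻¹ * ∫ t in (0 : ℝ)..T, ∑ s ∈ Z, ‖evolution L θ t v s‖ ^ 2)
      Filter.atTop (nhds (∑ K with K.card = N, ‖inner ℂ (energyBasis L K) v‖ ^ 2 *
        ∑ s ∈ Z, ‖energyBasis L K s‖ ^ 2)) := by
  have hinj : Set.InjOn (energy L θ) (Finset.univ.filter fun K : Finset (Fin L) => K.card = N) := by
    refine (nondegenerate_iff.mp hθ).mono fun K hK => ?_
    exact (Finset.mem_filter.mp (Finset.mem_coe.mp hK)).2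
  have h := tendsto_finsetSum Z fun s _ => tendsto_average_norm_sq _
    (fun K => inner ℂ (energyBasis L K) v * energyBasis L K s) _ hinj
  have hval : ∑ s ∈ Z, ∑ K with K.card = N,
      ‖inner ℂ (energyBasis L K) v * energyBasis L K s‖ ^ 2 =
      ∑ K with K.card = N, ‖inner ℂ (energyBasis L K) v‖ ^ 2 *
        ∑ s ∈ Z, ‖energyBasis L K s‖ ^ 2 := by
    rw [Finset.sum_comm]
    simp only [norm_mul, mul_pow, Finset.mul_sum]
  rw [hval] at h
  refine h.congr fun T => ?_
  simp only [evolution_coordinate _ _ hv]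
  rw [intervalIntegral.integral_finsetSum
    fun s _ => Continuous.intervalIntegrable (by fun_prop) _ _, Finset.mul_sum]

/-- Every normalized `N`-particle state thermalizes if the energies are nondegenerate. -/
lemma thermalization (hL : Odd L) {N : ℕ} (hN : 0 < N) {ρ : ℝ} (hρ : ρ = (N : ℝ) / L)
    (hρ5 : ρ ≤ 1 / 5) (hρN : 1 ≤ ρ * N) {θ : ℝ} (hθ : Nondegenerate L N θ) {v : Fock L}
    (hv : v ∈ sector L N) (hv1 : ‖v‖ = 1) :
    ∃ T : ℝ, 0 < T ∧ ∃ G : Set ℝ, G ⊆ Set.Icc 0 T ∧ IsFiniteUnionOfIntervals G ∧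
      1 - Real.exp (-(ρ / 4) * N) ≤ volume.real G / T ∧
      ∀ t ∈ G, 1 - Real.exp (-(ρ / 4) * N) <
        measureProb (numberOp (leftHalf L)) {n : ℝ | |n / N - 1 / 2| ≤ Real.sqrt (3 / 2 * ρ)}
          (evolution L θ t v) := by
  set Z : Finset (Finset (Fin L)) := Finset.univ.filter fun s =>
    ¬ |((leftHalf L ∩ s).card : ℝ) / N - 1 / 2| ≤ Real.sqrt (3 / 2 * ρ) with hZ
  have hlim := tendsto_average_unbalanced hθ hv Z
  have hle : ∑ K with K.card = N, ‖inner ℂ (energyBasis L K) v‖ ^ 2 *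
      ∑ s ∈ Z, ‖energyBasis L K s‖ ^ 2 ≤ 3 * Real.exp (-(3 * ρ * N)) := by
    calc _ ≤ ∑ K with K.card = N, ‖inner ℂ (energyBasis L K) v‖ ^ 2 *
          (3 * Real.exp (-(3 * ρ * N))) := by
          refine Finset.sum_le_sum fun K hK => ?_
          gcongr
          exact unbalanced_energyBasis_le hL hN hρ hρ5 (Finset.mem_filter.mp hK).2
      _ ≤ ∑ K, ‖inner ℂ (energyBasis L K) v‖ ^ 2 * (3 * Real.exp (-(3 * ρ * N))) :=
          Finset.sum_le_sum_of_subset_of_nonneg (Finset.filter_subset _ _)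
            fun K _ _ => by positivity
      _ = _ := by
          rw [← Finset.sum_mul, (energyBasis L).sum_sq_norm_inner_right, hv1, one_pow, one_mul]
  -- One factor is the allowed measurement error, the other the allowed fraction of bad times in
  -- Markov's inequality. Since `ρN ≥ 1`, it suffices that `e^{5/2} ≥ 7/2 > 3`.
  have hbig : 3 * Real.exp (-(3 * ρ * N)) <
      Real.exp (-(ρ / 4) * N) * Real.exp (-(ρ / 4) * N) := by
    have h1 : (3 : ℝ) < Real.exp (5 / 2 * (ρ * N)) := by
      have := Real.add_one_le_exp (5 / 2 * (ρ * N))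
      linarith
    calc _ < Real.exp (5 / 2 * (ρ * N)) * Real.exp (-(3 * ρ * N)) := by gcongr
      _ = _ := by
        rw [← Real.exp_add, ← Real.exp_add]
        congr 1
        ring
  obtain ⟨T, hTavg, hT⟩ := ((hlim.eventually_lt_const (hle.trans_lt hbig)).and
    (Filter.eventually_gt_atTop 0)).exists
  obtain ⟨G, hGT, hG, hGm, hGq⟩ := exists_intervals_of_average_lt
    (q := fun t => ∑ s ∈ Z, ‖evolution L θ t v s‖ ^ 2)
    (by simp only [evolution_coordinate _ _ hv]; fun_prop)
    (fun t => Finset.sum_nonneg fun s _ => by positivity) hT (Real.exp_pos _) hTavg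
  refine ⟨T, hT, G, hGT, hG, hGm, fun t ht => ?_⟩
  refine lt_of_lt_of_le ?_ (norm_sq_sub_le_measureProb (leftHalf L)
    {n : ℝ | |n / N - 1 / 2| ≤ Real.sqrt (3 / 2 * ρ)} (evolution L θ t v))
  rw [norm_sq_evolution, hv1, one_pow]
  exact sub_lt_sub_left (hGq t ht) 1

lemma uniformOnSphere_real_univ (E : Type*) [NormedAddCommGroup E] [InnerProductSpace ℂ E]
    [FiniteDimensional ℂ E] [MeasurableSpace E] [BorelSpace E] [Nontrivial E] :
    (uniformOnSphere E).real Set.univ = 1 := by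
  let : InnerProductSpace ℝ E := InnerProductSpace.complexToReal
  have : FiniteDimensional ℝ E := FiniteDimensional.complexToReal E
  have h0 : (volume : Measure E).toSphere Set.univ ≠ 0 := by
    rw [Ne, Measure.measure_univ_eq_zero]
    exact Measure.toSphere_ne_zero _
  rw [measureReal_def, uniformOnSphere, Measure.smul_apply, smul_eq_mul,
    ENNReal.inv_mul_cancel h0 (measure_ne_top _ _), ENNReal.toReal_one]

/-- Needed because `uniformOnSphere` is a probability measure only on a nonzero space. -/
lemma nontrivial_leftSector {N : ℕ} (h : N ≤ (L - 1) / 2) : Nontrivial (leftSector L N) := by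
  rw [← card_leftHalf] at h
  obtain ⟨s, hs, hsN⟩ := Finset.exists_subset_card_eq h
  have hmem : EuclideanSpace.single s (1 : ℂ) ∈ leftSector L N := by
    constructor <;> refine mem_eigenspace_numberOp.mpr fun s' hs' => ?_ <;>
    · have : s' = s := by
        by_contra h
        simp [h] at hs'
      subst this
      simp [Finset.inter_eq_right.mpr hs, hsN]
  refine nontrivial_of_ne (⟨_, hmem⟩ : leftSector L N) 0 fun h => ?_
  simpa using congrArg (fun w : leftSector L N => ‖(w : Fock L)‖) h

/-! ### Nondegeneracy for a prime number of sites -/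

/-- The product is the modulus of the field norm, a nonzero rational integer. -/
lemma one_le_prod_norm_embeddings {F : Type*} [Field F] [Algebra ℚ F]
    [FiniteDimensional ℚ F] {x : F} (hx : IsIntegral ℤ x) (hx0 : x ≠ 0) : 1 ≤ ∏ σ : F →ₐ[ℚ] ℂ, ‖σ x‖ := by
  obtain ⟨n, hn⟩ := IsIntegrallyClosed.isIntegral_iff.mp (Algebra.isIntegral_norm ℚ hx)
  have hn0 : n ≠ 0 := by
    rintro rfl
    rw [map_zero, eq_comm, Algebra.norm_eq_zero_iff] at hn
    exact hx0 hn
  have h := Algebra.norm_eq_prod_embeddings ℚ ℂ x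
  rw [← hn] at h
  rw [← norm_prod, ← h]
  simp only [algebraMap_int_eq, eq_intCast, map_intCast, Complex.norm_intCast]
  exact_mod_cast Int.one_le_abs hn0

/-- The sum `∑ (z^k + z^{-k})` over `k ∈ K` minus the same sum over `K'`. -/
def symmSumDiff {F : Type*} [Field F] (K K' : Finset (Fin L)) (z : F) : F :=
  ∑ k ∈ K, (z ^ (k : ℕ) + z⁻¹ ^ (k : ℕ)) - ∑ k ∈ K', (z ^ (k : ℕ) + z⁻¹ ^ (k : ℕ))

lemma symmSumDiff_inv {F : Type*} [Field F] (K K' : Finset (Fin L)) (z : F) :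
    symmSumDiff K K' z⁻¹ = symmSumDiff K K' z := by
  simp only [symmSumDiff, inv_inv, add_comm]

lemma norm_symmSumDiff_le (K K' : Finset (Fin L)) {z : ℂ} (hz : ‖z‖ = 1) :
    ‖symmSumDiff K K' z‖ ≤ 2 * K.card + 2 * K'.card := by
  have h : ∀ M : Finset (Fin L), ‖∑ k ∈ M, (z ^ (k : ℕ) + z⁻¹ ^ (k : ℕ))‖ ≤ 2 * M.card := by
    intro M
    refine (norm_sum_le_of_le M (n := fun _ => 2) fun k _ => ?_).trans (by simp [mul_comm])
    refine (norm_add_le _ _).trans ?_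
    simp [hz]
    norm_num
  exact (norm_sub_le _ _).trans (add_le_add (h K) (h K'))

/-- A nonzero real part of a difference of sums of roots of unity is not too small. -/
lemma one_le_norm_symmSumDiff (F : Type*) [Field F] [Algebra ℚ F]
    [IsCyclotomicExtension {L} ℚ F] (hL : 3 ≤ L) (K K' : Finset (Fin L))
    (h0 : symmSumDiff K K' (chainRoot L) ≠ 0) :
    1 ≤ ‖symmSumDiff K K' (chainRoot L)‖ ^ 2 *
      (2 * K.card + 2 * K'.card : ℝ) ^ (L.totient - 2) := by
  classical
  have hL0 : L ≠ 0 := by lia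
  have : NeZero L := ⟨hL0⟩
  have : FiniteDimensional ℚ F := IsCyclotomicExtension.finiteDimensional {L} ℚ F
  have : CharZero F := charZero_of_injective_algebraMap (algebraMap ℚ F).injective
  have hirr := Polynomial.cyclotomic.irreducible_rat (Nat.pos_of_ne_zero hL0)
  have hζ := IsCyclotomicExtension.zeta_spec L ℚ F
  set ζ := IsCyclotomicExtension.zeta L ℚ F with hζdef
  have hroot := chainRoot_isPrimitiveRoot hL0
  let e := hζ.embeddingsEquivPrimitiveRoots ℂ hirr
  have hmap : ∀ σ : F →ₐ[ℚ] ℂ,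
      σ (symmSumDiff K K' ζ) = symmSumDiff K K' (σ ζ) := by
    intro σ
    simp [symmSumDiff]
  have he : ∀ z : primitiveRoots L ℂ, (e.symm z) ζ = z := by
    intro z
    rw [← hζ.embeddingsEquivPrimitiveRoots_apply_coe ℂ hirr]
    exact congrArg Subtype.val (e.apply_symm_apply z)
  have hpos := Nat.pos_of_ne_zero hL0
  let σ := e.symm ⟨chainRoot L, (mem_primitiveRoots hpos).mpr hroot⟩
  let τ := e.symm ⟨(chainRoot L)⁻¹, (mem_primitiveRoots hpos).mpr hroot.inv⟩
  have hσ : σ ζ = chainRoot L := he _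
  have hτ : τ ζ = (chainRoot L)⁻¹ := he _
  -- The embeddings with `ζ ↦ e^{±2πi/L}` differ as `L ≥ 3`, and `symmSumDiff` takes the same value
  -- at both. So the small conjugate occurs twice in the norm, leaving `φ(L) - 2` conjugates for the
  -- trivial bound.
  have hne : τ ≠ σ := by
    intro h
    have h1 : (chainRoot L)⁻¹ = chainRoot L := by rw [← hτ, h, hσ]
    have h2 : chainRoot L ^ 2 = 1 := by
      rw [sq]
      nth_rewrite 1 [← h1]
      exact inv_mul_cancel₀ (hroot.ne_zero hL0)
    have := Nat.le_of_dvd two_pos (hroot.dvd_of_pow_eq_one _ h2)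
    lia
  have hint : IsIntegral ℤ (symmSumDiff K K' ζ) := by
    have h1 : IsIntegral ℤ ζ := hζ.isIntegral hpos
    have h2 : IsIntegral ℤ ζ⁻¹ := hζ.inv.isIntegral hpos
    exact (IsIntegral.sum _ fun k _ => (h1.pow _).add (h2.pow _)).sub
      (IsIntegral.sum _ fun k _ => (h1.pow _).add (h2.pow _))
  have hx0 : symmSumDiff K K' ζ ≠ 0 := by
    intro h
    apply h0
    rw [← hσ, ← hmap, h, map_zero]
  refine (one_le_prod_norm_embeddings hint hx0).trans ?_
  rw [← Finset.mul_prod_erase _ _ (Finset.mem_univ σ), ← Finset.mul_prod_erase _ _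
    (Finset.mem_erase.mpr ⟨hne, Finset.mem_univ τ⟩), hmap, hmap, hσ, hτ, symmSumDiff_inv,
    ← mul_assoc, ← sq]
  gcongr
  have hcard : ((Finset.univ.erase σ).erase τ).card = L.totient - 2 := by
    rw [Finset.card_erase_of_mem (Finset.mem_erase.mpr ⟨hne, Finset.mem_univ τ⟩),
      Finset.card_erase_of_mem (Finset.mem_univ σ), Finset.card_univ, Fintype.card_congr e,
      Fintype.card_coe, hroot.card_primitiveRoots]
    lia
  rw [← hcard]
  rw [← Finset.prod_const]
  refine Finset.prod_le_prod (fun _ _ => norm_nonneg _) fun ψ _ => ?_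
  rw [hmap]
  refine norm_symmSumDiff_le K K' ?_
  exact (hζ.map_of_injective ψ.injective).norm'_eq_one hL0

/-- The difference `P` of the two sums of monomials has degree at most `L - 1` and is divisible by
the cyclotomic polynomial, which has exactly this degree. So `P` is a constant multiple of it;
evaluation at `1`, where `P` vanishes and the cyclotomic polynomial equals `L`, shows that the
constant is zero. -/
lemma eq_of_sum_chainRoot_eq (hL : L.Prime) {K K' : Finset (Fin L)} (hcard : K.card = K'.card)
    (h : ∑ k ∈ K, chainRoot L ^ (k : ℕ) = ∑ k ∈ K', chainRoot L ^ (k : ℕ)) : K = K' := by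
  have : Fact L.Prime := ⟨hL⟩
  set P : Polynomial ℚ := ∑ k ∈ K, Polynomial.X ^ (k : ℕ) - ∑ k ∈ K', Polynomial.X ^ (k : ℕ)
    with hP
  have hcoeff : ∀ j : Fin L, P.coeff j = (if j ∈ K then 1 else 0) - (if j ∈ K' then 1 else 0) := by
    intro j
    simp only [hP, Polynomial.coeff_sub, Polynomial.finsetSum_coeff, Polynomial.coeff_X_pow,
      Fin.val_inj, Finset.sum_ite_eq]
  have hdeg : P.natDegree ≤ L - 1 := by
    have h1 : ∀ M : Finset (Fin L),
        (∑ k ∈ M, (Polynomial.X : Polynomial ℚ) ^ (k : ℕ)).natDegree ≤ L - 1 := fun M =>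
      Polynomial.natDegree_sum_le_of_forall_le _ _ fun k _ =>
        (Polynomial.natDegree_X_pow_le _).trans (by have := k.isLt; lia)
    exact (Polynomial.natDegree_sub_le _ _).trans (max_le (h1 K) (h1 K'))
  have hdvd : Polynomial.cyclotomic L ℚ ∣ P := by
    rw [Polynomial.cyclotomic_eq_minpoly_rat (chainRoot_isPrimitiveRoot hL.ne_zero) hL.pos]
    refine minpoly.dvd _ _ ?_
    simp [hP, h]
  have heval : P.eval 1 = 0 := by
    simp [hP, Polynomial.eval_finsetSum, hcard]
  have hP0 : P = 0 := by
    by_contra hne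
    obtain ⟨R, hR⟩ := hdvd
    have hR0 : R ≠ 0 := by rintro rfl; exact hne (by rw [hR, mul_zero])
    have hd := congrArg Polynomial.natDegree hR
    rw [Polynomial.natDegree_mul (Polynomial.cyclotomic_ne_zero L ℚ) hR0,
      Polynomial.natDegree_cyclotomic, Nat.totient_prime hL] at hd
    have hRc := Polynomial.eq_C_of_natDegree_eq_zero (show R.natDegree = 0 by lia)
    rw [hR, Polynomial.eval_mul, Polynomial.eval_one_cyclotomic_prime, hRc,
      Polynomial.eval_C] at heval
    rcases mul_eq_zero.mp heval with h1 | h1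
    · exact hL.ne_zero (by exact_mod_cast h1)
    · exact hR0 (by rw [hRc, h1, map_zero])
  ext j
  have := hcoeff j
  rw [hP0, Polynomial.coeff_zero] at this
  clear_value P
  by_cases h1 : j ∈ K <;> by_cases h2 : j ∈ K' <;> simp [h1, h2] at this ⊢

lemma energy_eq_re (θ : ℝ) (K : Finset (Fin L)) :
    energy L θ K =
      2 * (Complex.exp (Complex.I * θ) * ∑ k ∈ K, chainRoot L ^ (k : ℕ)).re := by
  rw [energy, Finset.mul_sum, Complex.re_sum, Finset.mul_sum]
  refine Finset.sum_congr rfl fun k _ => ?_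
  rw [orbitalEnergy, chainRoot, ← Complex.exp_nat_mul, ← Complex.exp_add]
  have : Complex.I * θ + (k : ℕ) * (2 * Real.pi * Complex.I / L) =
      ((2 * Real.pi * (k : ℕ) / L + θ : ℝ) : ℂ) * Complex.I := by push_cast; ring
  rw [this, Complex.exp_ofReal_mul_I_re]

lemma symmSumDiff_chainRoot (hL : L ≠ 0) (K K' : Finset (Fin L)) :
    symmSumDiff K K' (chainRoot L) = ((2 * (∑ k ∈ K, chainRoot L ^ (k : ℕ) -
      ∑ k ∈ K', chainRoot L ^ (k : ℕ)).re : ℝ) : ℂ) := by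
  have hinv : (chainRoot L)⁻¹ = starRingEnd ℂ (chainRoot L) :=
    Complex.inv_eq_conj (norm_chainRoot hL)
  rw [Complex.ofReal_mul, Complex.re_eq_add_conj]
  simp only [symmSumDiff, hinv, Finset.sum_add_distrib, map_sub, map_sum, map_pow]
  push_cast
  ring

lemma nondegenerate_of_prime (hL : L.Prime) (hodd : Odd L) {N : ℕ} (hN : 0 < N)
    (hNL : (N : ℝ) ≤ ((L : ℝ) - 1) / 4) :
    Nondegenerate L N ((4 * (N : ℝ)) ^ (-(((L : ℝ) - 1) / 2))) := by
  rw [nondegenerate_iff]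
  obtain ⟨m, hm⟩ := hodd
  have hN1 : (1 : ℝ) ≤ N := by exact_mod_cast hN
  have hm2 : 2 ≤ m := by
    rw [hm] at hNL
    push_cast at hNL
    have : (2 : ℝ) ≤ m := by linarith
    exact_mod_cast this
  have hθ : (4 * (N : ℝ)) ^ (-(((L : ℝ) - 1) / 2)) = ((4 * (N : ℝ)) ^ m)⁻¹ := by
    rw [Real.rpow_neg (by positivity), ← Real.rpow_natCast, hm]
    congr 2
    push_cast
    ring
  rw [hθ]
  set θ : ℝ := ((4 * (N : ℝ)) ^ m)⁻¹ with hθdef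
  have hθ0 : 0 < θ := by positivity
  have hθ1 : θ ≤ 1 := inv_le_one_of_one_le₀ (one_le_pow₀ (by linarith))
  have hsin0 : 0 < Real.sin θ := Real.sin_pos_of_pos_of_le_one hθ0 hθ1
  have hsin : Real.sin θ < θ := Real.sin_lt hθ0
  intro K hK K' hK' hE
  simp only [Set.mem_ofPred_eq] at hK hK'
  set A : ℂ := ∑ k ∈ K, chainRoot L ^ (k : ℕ) - ∑ k ∈ K', chainRoot L ^ (k : ℕ) with hA
  have hre : (Complex.exp (Complex.I * θ) * A).re = 0 := by
    rw [energy_eq_re, energy_eq_re] at hE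
    rw [hA, mul_sub, Complex.sub_re]
    linarith
  have hre2 : A.re * Real.cos θ = A.im * Real.sin θ := by
    rw [mul_comm Complex.I, Complex.mul_re, Complex.exp_ofReal_mul_I_re,
      Complex.exp_ofReal_mul_I_im] at hre
    linarith
  -- `e^{iθ} A` is purely imaginary, so `A` makes the angle `θ` with the imaginary axis.
  have hsq : A.re ^ 2 = ‖A‖ ^ 2 * Real.sin θ ^ 2 := by
    rw [Complex.sq_norm, Complex.normSq_apply]
    have h1 := congrArg (· ^ 2) hre2
    simp only [mul_pow] at h1
    have h2 := Real.sin_sq_add_cos_sq θ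
    linear_combination h1 - A.re ^ 2 * h2
  have hAle : ‖A‖ ≤ 2 * N := by
    have h : ∀ M : Finset (Fin L), ‖∑ k ∈ M, chainRoot L ^ (k : ℕ)‖ ≤ M.card := fun M =>
      (norm_sum_le_of_le M (n := fun _ => 1) fun k _ => by
        rw [norm_pow, norm_chainRoot hL.ne_zero, one_pow]).trans (by simp)
    refine (norm_sub_le _ _).trans ((add_le_add (h K) (h K')).trans (le_of_eq ?_))
    rw [hK, hK', two_mul]
  have hA0 : A = 0 := by
    by_contra hne
    have hApos : 0 < ‖A‖ := norm_pos_iff.mpr hne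
    have h0 : symmSumDiff K K' (chainRoot L) ≠ 0 := by
      rw [symmSumDiff_chainRoot hL.ne_zero, Complex.ofReal_ne_zero, ← hA]
      intro h
      have : A.re = 0 := by linarith
      rw [this] at hsq
      have : 0 < ‖A‖ ^ 2 * Real.sin θ ^ 2 := by positivity
      linarith
    have : NeZero (L : ℚ) := ⟨Nat.cast_ne_zero.mpr hL.ne_zero⟩
    have : NeZero L := ⟨hL.ne_zero⟩
    let : Algebra ℚ (CyclotomicField L ℚ) := CyclotomicField.algebra L ℚ
    have : IsCyclotomicExtension {L} ℚ (CyclotomicField L ℚ) :=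
      CyclotomicField.isCyclotomicExtension L ℚ
    have hlow := one_le_norm_symmSumDiff (CyclotomicField L ℚ) (by lia) K K' h0
    rw [symmSumDiff_chainRoot hL.ne_zero, ← hA, Complex.norm_real, Real.norm_eq_abs, sq_abs,
      mul_pow, hsq, hK, hK', Nat.totient_prime hL, hm] at hlow
    have hexp : 2 * m + 1 - 1 - 2 = 2 * (m - 1) := by lia
    have hlt : ‖A‖ ^ 2 * Real.sin θ ^ 2 < (2 * N) ^ 2 * θ ^ 2 := by
      calc _ < ‖A‖ ^ 2 * θ ^ 2 := by gcongr
        _ ≤ _ := by gcongr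
    -- The value of `θ` makes upper and lower bound meet exactly: `(4Nθ)² (4N)^{L-3} = 1`. The
    -- contradiction comes from the strict inequality `sin θ < θ`.
    have hpow : (2 : ℝ) ^ 2 * ((2 * N) ^ 2 * θ ^ 2) * (2 * N + 2 * N) ^ (2 * m + 1 - 1 - 2) = 1 := by
      obtain ⟨n, rfl⟩ : ∃ n, m = n + 1 := ⟨m - 1, by lia⟩
      rw [hexp, hθdef, Nat.add_sub_cancel, inv_pow, ← pow_mul, ← two_mul,
        show (n + 1) * 2 = 2 * n + 2 by ring, pow_add]
      have : (4 : ℝ) * N ≠ 0 := by positivity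
      rw [show 2 * (2 * (N : ℝ)) = 4 * N by ring]
      field_simp
      ring
    have : (2 : ℝ) ^ 2 * (‖A‖ ^ 2 * Real.sin θ ^ 2) * (2 * N + 2 * N) ^ (2 * m + 1 - 1 - 2) <
        2 ^ 2 * ((2 * N) ^ 2 * θ ^ 2) * (2 * N + 2 * N) ^ (2 * m + 1 - 1 - 2) := by gcongr
    linarith
  exact eq_of_sum_chainRoot_eq hL (hK.trans hK'.symm) (sub_eq_zero.mp hA0)

end FermionChain

theorem mainTheorem1 :
    (∀ ρ₀ : ℝ, 0 < ρ₀ → ∃ N₀ : ℕ, ∀ N L : ℕ, N₀ ≤ N → Odd L →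
      ∀ ρ : ℝ, ρ = (N : ℝ) / (L : ℝ) → ρ₀ ≤ ρ → ρ ≤ 1 / 5 →
      ∀ θ : ℝ, FermionChain.Nondegenerate L N θ →
        ∃ A : Set (Metric.sphere (0 : FermionChain.leftSector L N) 1),
          MeasurableSet A ∧
          1 - Real.exp (-(ρ / 3) * N) <
            (FermionChain.uniformOnSphere (FermionChain.leftSector L N)).real A ∧
          ∀ Φ ∈ A, ∃ T : ℝ, 0 < T ∧ ∃ G : Set ℝ, G ⊆ Set.Icc 0 T ∧
            FermionChain.IsFiniteUnionOfIntervals G ∧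
            1 - Real.exp (-(ρ / 4) * N) ≤ volume.real G / T ∧
            ∀ t ∈ G,
              1 - Real.exp (-(ρ / 4) * N) <
                FermionChain.measureProb (FermionChain.numberOp (FermionChain.leftHalf L))
                  {n : ℝ | |n / N - 1 / 2| ≤ Real.sqrt (3 / 2 * ρ)}
                  (FermionChain.evolution L θ t ((Φ : FermionChain.leftSector L N) :
                    FermionChain.Fock L))) ∧
    (∀ L N : ℕ, L.Prime → Odd L → 0 < N → (N : ℝ) ≤ ((L : ℝ) - 1) / 4 →
      FermionChain.Nondegenerate L N ((4 * (N : ℝ)) ^ (-(((L : ℝ) - 1) / 2)))) := by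
  -- `N ≥ 1/ρ₀` is all that is required of `N₀` besides positivity: it gives `ρN ≥ 1`.
  refine ⟨fun ρ₀ hρ₀ => ⟨max 1 ⌈1 / ρ₀⌉₊, ?_⟩, fun L N hL hodd hN hNL =>
    FermionChain.nondegenerate_of_prime hL hodd hN hNL⟩
  intro N L hN hL ρ hρ hρ₀ρ hρ5 θ hθ
  have hN1 : 0 < N := lt_of_lt_of_le one_pos ((le_max_left _ _).trans hN)
  have hLpos : (0 : ℝ) < L := by exact_mod_cast hL.pos
  have hρN : 1 ≤ ρ * N := by
    have h1 : 1 / ρ₀ ≤ N := (Nat.le_ceil _).trans (by exact_mod_cast (le_max_right _ _).trans hN)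
    rw [div_le_iff₀ hρ₀] at h1
    nlinarith
  have hNL : N ≤ (L - 1) / 2 := by
    rw [hρ, div_le_iff₀ hLpos] at hρ5
    have : 5 * N ≤ L := by
      have : (5 : ℝ) * N ≤ L := by linarith
      exact_mod_cast this
    lia
  have := FermionChain.nontrivial_leftSector hNL
  -- Every initial state thermalizes, so the event has probability one.
  refine ⟨Set.univ, MeasurableSet.univ, ?_, fun Φ _ => ?_⟩
  · rw [FermionChain.uniformOnSphere_real_univ]
    exact sub_lt_self 1 (Real.exp_pos _)
  · refine FermionChain.thermalization hL hN1 hρ hρ5 hρN hθ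
      (Φ : FermionChain.leftSector L N).2.1 ?_
    exact mem_sphere_zero_iff_norm.mp Φ.2
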